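/- Conventions. A square grid domain $\Omega$ is a finite simply connected union of faces of $\mathbb{Z}^2$ whose boundary is a simple closed curve; $\mathcal{E}$ is its set of edges (identified with their midpoints) and $\partial\mathcal{E}\subset\mathcal{E}$ its set of boundary edges. For $e\in\partial\mathcal{E}$ let $\tau_{\mathrm{ccw}}(e)\in\{\pm1,\pm i\}$ be the counterclockwise unit tangent and $\tau_{\mathrm{cw}}=-\tau_{\mathrm{ccw}}$; $f\parallel\tau^{-1/2}$ at $e$ means that $f(e)$ is a real multiple of a square root of $\tau(e)^{-1}$. With $\lambda=e^{i\pi/4}$, a function $F:\mathcal{E}\to\mathbb{C}$ is s-holomorphic if on every face of $\Omega$ with east, north, west and south edges $E,N,W,S$ $$F(N)+\lambda\overline{F(N)}=F(E)+\lambda\overline{F(E)},\qquad F(N)+\lambda^{-1}\overline{F(N)}=F(W)+\lambda^{-1}\overline{F(W)},$$ $$F(S)+\lambda^{3}\overline{F(S)}=F(E)+\lambda^{3}\overline{F(E)},\qquad F(S)+\lambda^{-3}\overline{F(S)}=F(W)+\lambda^{-3}\overline{F(W)}.$$ RPS operators. For $\mathfrak{b}\subset\partial\mathcal{E}$ let $\mathcal{R}_\Omega^{\mathfrak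 b}$ (resp. $\mathcal{I}_\Omega^{\mathfrak b}$) be the real vector space of functions $f:\mathfrak{b}\to\mathbb{C}$ with $f\parallel\tau_{\mathrm{ccw}}^{-1/2}$ (resp. $f\parallel\tau_{\mathrm{cw}}^{-1/2}$) on $\mathfrak{b}$. The operator $U_\Omega^{\mathfrak b}:\mathcal{R}_\Omega^{\mathfrak b}\to\mathcal{I}_\Omega^{\mathfrak b}$ is the real-linear map $u\mapsto v$, where $v$ is the unique element of $\mathcal{I}_\Omega^{\mathfrak b}$ such that $u+v$ has an s-holomorphic extension $h:\mathcal{E}\to\mathbb{C}$ with $h\parallel\tau_{\mathrm{cw}}^{-1/2}$ on $\partial\mathcal{E}\setminus\mathfrak{b}$. Observable. Let $\alpha=e^{-2\beta_c}$ with $\beta_c=\frac12\ln(\sqrt2+1)$. For a finite union $\Omega$ of faces, $a\in\partial\mathcal{E}$ and $z\in\mathcal{E}$ with $z\neq a$, set $$f_\Omega(a,z)=\frac1{\mathcal Z}\sum_{\gamma}\alpha^{|\gamma|+1}e^{-\frac i2\mathbf W(\gamma:a\to z)},\qquad \mathcal Z=\sum_\omega\alpha^{|\omega|},\qquad f_\Omega(a,a)=1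 .$$ Here $\omega$ runs over the sets of dual edges (joining neighbouring faces of $\Omega$) that have even degree at every face of $\Omega$. The sum over $\gamma$ runs over the sets of dual edges not containing the one that crosses $z$, together with a choice of a face $q$ of $\Omega$ next to $z$, such that, after the half-edge from $a$ into $\Omega$ and the half-edge from $q$ to $z$ are added, every face has even degree. $\mathbf W(\gamma:a\to z)$ is the total turning angle of a path from $a$ to $z$ in $\gamma$ (with the two half-edges) that uses no edge twice and turns left or right at every face where all four directions are occupied; the phase does not depend on the choice of this path. Theorem. Let $\Omega_1,\Omega_2$ be square grid domains with disjoint interiors and with edges $\mathcal{E}_1,\mathcal{E}_2$, let $\mathfrak{b}=\partial\mathcal{E}_1\cap\partial\mathcal{E}_2$ and $\Omega=\Omega_1\cup\Omega_2$. The operators $U_1=U_{\Omega_1}^{\mathfrak b}$ and $U_2=U_{\Omega_2}^{\mathfrak b}$ are well defined. Write $\mathcal{R}_j=\mathcal{R}_{\Omega_j}^{\mathfrak b}$ and $\mathcal{I}_j=\mathcal{I}_{\Omega_j}^{\mathfrak b}$, so that $\mathcal{R}_1=\mathcal{I}_2$ and $\mathcal{R}_2=\mathcal{I}_1$. Then $\mathrm{Id}-U_1U_2:\mathcal{R}_2\to\mathcal{R}_2$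 is invertible. Its inverse $Q=(\mathrm{Id}-U_1U_2)^{-1}$ is the restriction to $\mathcal{R}_2$ of a unique complex matrix $(Q_{k,\ell})_{k,\ell\in\mathfrak b}$, and for all $x\in\partial\mathcal{E}_1\setminus\mathfrak{b}$ and $y\in\mathcal{E}_2$ $$f_\Omega(x,y)=\sum_{k,\ell\in\mathfrak b}f_{\Omega_2}(k,y)\,Q_{k,\ell}\,f_{\Omega_1}(x,\ell).$$ -/

import Mathlib

open scoped Matrix

namespace IsingGluing

/-! ### Square grid domains

A face is named by its lower left corner: `(x, y)` is the unit square `[x, x+1] × [y, y+1]`.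
Directions are numbered counterclockwise: `0` = east, `1` = north, `2` = west, `3` = south.
A (dual) edge is identified with the edge that it crosses, as is an edge with its midpoint. -/

/-- A face of the square lattice `ℤ²`, named by its lower left corner. -/
abbrev Face : Type := ℤ × ℤ

/-- `0` = east, `1` = north, `2` = west, `3` = south. -/
abbrev Dir : Type := Fin 4

/-- Edges of `ℤ²`: `hor x y` joins `(x, y)` to `(x + 1, y)`, and `ver x y` joins `(x, y)` to
`(x, y + 1)`. -/
inductive GridEdge : Type
  | hor (x y : ℤ) : GridEdge
  | ver (x y : ℤ) : GridEdge
  deriving DecidableEq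

/-- The side of the face `p` in direction `d`. -/
def side (p : Face) (d : Dir) : GridEdge :=
  match d with
  | 0 => .ver (p.1 + 1) p.2
  | 1 => .hor p.1 (p.2 + 1)
  | 2 => .ver p.1 p.2
  | 3 => .hor p.1 p.2

/-- The face next to `p` in direction `d`. -/
def step (p : Face) (d : Dir) : Face :=
  match d with
  | 0 => (p.1 + 1, p.2)
  | 1 => (p.1, p.2 + 1)
  | 2 => (p.1 - 1, p.2)
  | 3 => (p.1, p.2 - 1)

/-- The unit tangent of an edge, pointing east or north. -/
noncomputable def tangent : GridEdge → ℂ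
  | .hor _ _ => 1
  | .ver _ _ => Complex.I

/-- The face on the left of an edge that is traversed along `tangent`. -/
def leftFace : GridEdge → Face
  | .hor x y => (x, y)
  | .ver x y => (x - 1, y)

/-- The face on the right of an edge that is traversed along `tangent`. -/
def rightFace : GridEdge → Face
  | .hor x y => (x, y - 1)
  | .ver x y => (x, y)

/-- Two faces are neighbours if they share an edge. -/
def faceGraph : SimpleGraph Face := SimpleGraph.fromRel (fun p q => ∃ d, q = step p d)

/-- A square grid domain, given by its finite set of faces: the union of the faces is simply
connected and its boundary is a simple closed curve. For a finite set of unit squares this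
says that the set of faces is nonempty and connected through edges, and that so is its
complement (no holes, and no two parts that meet in a vertex only). -/
def IsGridDomain (F : Finset Face) : Prop :=
  (faceGraph.induce (F : Set Face)).Connected ∧ (faceGraph.induce ((F : Set Face)ᶜ)).Connected

/-- The edges of the domain with faces `F`. -/
def edges (F : Finset Face) : Finset GridEdge :=
  F.biUnion fun p => Finset.univ.image (side p)

/-- The edges between two faces of `F`. They stand also for the dual edges. -/
def interiorEdges (F : Finset Face) : Finset GridEdge :=
  (edges F).filter fun e => leftFace e ∈ F ∧ rightFace e ∈ F

/-- The boundary edges of the domain with faces `F`. -/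
def boundaryEdges (F : Finset Face) : Finset GridEdge :=
  (edges F).filter fun e => ¬ (leftFace e ∈ F ∧ rightFace e ∈ F)

/-- The counterclockwise unit tangent at a boundary edge (the domain lies on its left). -/
noncomputable def tauCCW (F : Finset Face) (e : GridEdge) : ℂ :=
  if leftFace e ∈ F then tangent e else -tangent e

/-- The clockwise unit tangent at a boundary edge. -/
noncomputable def tauCW (F : Finset Face) (e : GridEdge) : ℂ := -tauCCW F e

/-- The real line spanned by `τ^(-1/2)` (it does not depend on the choice of the root). -/
noncomputable def rootLine (τ : ℂ) : Submodule ℝ ℂ :=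
  Submodule.span ℝ {τ ^ (-(1 / 2) : ℂ)}

/-! ### S-holomorphicity and the Riemann Poincaré-Steklov operator -/

/-- The constant `λ = exp (i π / 4)`. -/
noncomputable def lam : ℂ := Complex.exp (Complex.I * Real.pi / 4)

/-- The s-holomorphicity equations on every face of `F` (`0, 1, 2, 3` = E, N, W, S). Only the
values of `h` on the edges of `F` matter. -/
def SHolomorphic (F : Finset Face) (h : GridEdge → ℂ) : Prop :=
  ∀ p ∈ F,
    h (side p 1) + lam * star (h (side p 1)) = h (side p 0) + lam * star (h (side p 0)) ∧
    h (side p 1) + lam⁻¹ * star (h (side p 1)) = h (side p 2) + lam⁻¹ * star (h (side p 2)) ∧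
    h (side p 3) + lam ^ 3 * star (h (side p 3)) =
      h (side p 0) + lam ^ 3 * star (h (side p 0)) ∧
    h (side p 3) + (lam ^ 3)⁻¹ * star (h (side p 3)) =
      h (side p 2) + (lam ^ 3)⁻¹ * star (h (side p 2))

/-- The real vector space of functions `f : b → ℂ` with `f ∥ τ_ccw^(-1/2)`. -/
noncomputable def dataR (F : Finset Face) (b : Finset GridEdge) : Submodule ℝ (b → ℂ) :=
  Submodule.pi Set.univ fun e => rootLine (tauCCW F e)

/-- The real vector space of functions `f : b → ℂ` with `f ∥ τ_cw^(-1/2)`. -/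
noncomputable def dataI (F : Finset Face) (b : Finset GridEdge) : Submodule ℝ (b → ℂ) :=
  Submodule.pi Set.univ fun e => rootLine (tauCW F e)

/-- `u + v` has an s-holomorphic extension `h` to the domain with `h ∥ τ_cw^(-1/2)` on the
boundary edges outside of `b`. -/
def HasSHolExtension (F : Finset Face) (b : Finset GridEdge) (u : dataR F b) (v : dataI F b) :
    Prop :=
  ∃ h : GridEdge → ℂ, SHolomorphic F h ∧
    (∀ e : b, h e = (u : b → ℂ) e + (v : b → ℂ) e) ∧
    ∀ e ∈ boundaryEdges F \ b, h e ∈ rootLine (tauCW F e)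

open Classical in
/-- The RPS operator: the real-linear map `u ↦ v` such that `u + v` has an s-holomorphic
extension as above (and `0` if there were no such map). -/
noncomputable def rps (F : Finset Face) (b : Finset GridEdge) : dataR F b →ₗ[ℝ] dataI F b :=
  if h : ∃ U : dataR F b →ₗ[ℝ] dataI F b, ∀ u, HasSHolExtension F b u (U u) then h.choose else 0

/-- The common boundary edges of two domains. -/
def commonBoundary (F₁ F₂ : Finset Face) : Finset GridEdge :=
  boundaryEdges F₁ ∩ boundaryEdges F₂

theorem leftFace_mem_or {F : Finset Face} {e : GridEdge} (he : e ∈ boundaryEdges F) :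
    leftFace e ∈ F ∨ rightFace e ∈ F := by
  simp only [boundaryEdges, edges, Finset.mem_filter, Finset.mem_biUnion, Finset.mem_image,
    Finset.mem_univ, true_and] at he
  obtain ⟨⟨p, hp, d, rfl⟩, -⟩ := he
  fin_cases d <;> simp [side, leftFace, rightFace, hp]

theorem tauCW_eq_tauCCW {F₁ F₂ : Finset Face} (hd : Disjoint F₁ F₂) {e : GridEdge}
    (h₁ : e ∈ boundaryEdges F₁) (h₂ : e ∈ boundaryEdges F₂) : tauCW F₁ e = tauCCW F₂ e := by
  have a₁ := leftFace_mem_or h₁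
  have a₂ := leftFace_mem_or h₂
  have b₁ := (Finset.mem_filter.mp h₁).2
  have b₂ := (Finset.mem_filter.mp h₂).2
  have c : ∀ p ∈ F₁, p ∉ F₂ := fun p hp => Finset.disjoint_left.mp hd hp
  have c₁ := c (leftFace e)
  have c₂ := c (rightFace e)
  clear c
  unfold tauCW tauCCW
  by_cases l₁ : leftFace e ∈ F₁ <;> by_cases l₂ : leftFace e ∈ F₂ <;> simp_all

/-- On the common boundary `𝓘₁ = 𝓡₂`. -/
theorem dataI_eq_dataR {F₁ F₂ : Finset Face} (hd : Disjoint F₁ F₂) {b : Finset GridEdge}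
    (h₁ : b ⊆ boundaryEdges F₁) (h₂ : b ⊆ boundaryEdges F₂) : dataI F₁ b = dataR F₂ b := by
  unfold dataI dataR
  congr 1
  funext e
  rw [tauCW_eq_tauCCW hd (h₁ e.2) (h₂ e.2)]

/-- The composition `U₁ U₂ : 𝓡₂ → 𝓘₂ = 𝓡₁ → 𝓘₁ = 𝓡₂` of the RPS operators of two domains with
disjoint interiors, on their common boundary. -/
noncomputable def rpsComp (F₁ F₂ : Finset Face) (hd : Disjoint F₁ F₂) :
    Module.End ℝ (dataR F₂ (commonBoundary F₁ F₂)) :=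
  (LinearEquiv.ofEq _ _
      (dataI_eq_dataR hd Finset.inter_subset_left Finset.inter_subset_right)).toLinearMap ∘ₗ
    rps F₁ (commonBoundary F₁ F₂) ∘ₗ
    (LinearEquiv.ofEq _ _
      (dataI_eq_dataR hd.symm Finset.inter_subset_right Finset.inter_subset_left)).toLinearMap ∘ₗ
    rps F₂ (commonBoundary F₁ F₂)

/-- The complex matrix `M` represents the real-linear operator `Q` on the Cauchy data space
`𝓡` (this space spans `b → ℂ` over `ℂ`, so that `Q` has one such matrix). -/
def IsMatrixOf {F : Finset Face} {b : Finset GridEdge} (Q : Module.End ℝ (dataR F b))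
    (M : Matrix b b ℂ) : Prop :=
  ∀ u : dataR F b, M *ᵥ (u : b → ℂ) = (Q u : b → ℂ)

/-! ### The critical Ising parafermionic observable -/

/-- The weight `α = exp (-2 β_c)` of a dual edge, with `β_c = log (√2 + 1) / 2`. -/
noncomputable def criticalWeight : ℝ := Real.exp (-2 * (1 / 2 * Real.log (√2 + 1)))

/-- The number of (dual) edges of `γ` at the face `p`. -/
def degree (γ : Finset GridEdge) (p : Face) : ℕ :=
  (Finset.univ.filter fun d : Dir => side p d ∈ γ).card

/-- The face of the domain at a boundary edge `a`, and the direction into the domain. -/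
def entry (F : Finset Face) (a : GridEdge) : Face × Dir :=
  match a with
  | .hor x y => if leftFace (.hor x y) ∈ F then (leftFace (.hor x y), 1)
      else (rightFace (.hor x y), 3)
  | .ver x y => if leftFace (.ver x y) ∈ F then (leftFace (.ver x y), 2)
      else (rightFace (.ver x y), 0)

/-- The collections of loops: sets of dual edges with an even degree at every face. -/
def loopConfigs (F : Finset Face) : Finset (Finset GridEdge) :=
  (interiorEdges F).powerset.filter fun ω => ∀ p ∈ F, Even (degree ω p)

/-- The low temperature partition function. -/
noncomputable def partitionFunction (F : Finset Face) : ℝ :=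
  ∑ ω ∈ loopConfigs F, criticalWeight ^ ω.card

/-- The collections of dual edges which, with the half-edge from the boundary edge `a` into the
domain and the half-edge from the face `q` to `z`, consist of loops and a path from `a` to `z`:
each face belongs to an even number of edges and half-edges. The dual edge of `z`, of which only
a half is used, is not in the collection. -/
def pathConfigs (F : Finset Face) (a z : GridEdge) (q : Face) : Finset (Finset GridEdge) :=
  ((interiorEdges F).erase z).powerset.filter fun γ => ∀ p ∈ F,
    Even (degree γ p + (if p = (entry F a).1 then 1 else 0) + (if p = q then 1 else 0))

/-- The configuration has an edge or a half-edge at the face `p` in direction `d`. -/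
def Occupied (γ : Finset GridEdge) (a z : GridEdge) (q p : Face) (d : Dir) : Prop :=
  side p d ∈ γ ∨ side p d = a ∨ (p = q ∧ side p d = z)

/-- A path that comes into the face `p` with direction `d` may leave it with direction `d'`:
where all four directions are occupied it has to turn left or right, so that the loops and the
path do not cross. -/
def TurnAllowed (γ : Finset GridEdge) (a z : GridEdge) (q p : Face) (d d' : Dir) : Prop :=
  (∀ k, Occupied γ a z q p k) → d' ≠ d

/-- The list of directions leads from the face `p`, entered with direction `d`, along edges of
`γ` to the face `q` and then along the last half-edge to `z`. -/
def LeadsTo (γ : Finset GridEdge) (a z : GridEdge) (q : Face) : Face → Dir → List Dir → Prop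
  | _, _, [] => False
  | p, d, [d'] => p = q ∧ side p d' = z ∧ TurnAllowed γ a z q p d d'
  | p, d, d' :: d'' :: l => side p d' ∈ γ ∧ TurnAllowed γ a z q p d d' ∧
      LeadsTo γ a z q (step p d') d' (d'' :: l)

/-- The edges that are used by a list of directions. -/
def edgesAlong : Face → List Dir → List GridEdge
  | _, [] => []
  | p, d :: l => side p d :: edgesAlong (step p d) l

/-- The turn from direction `d` to direction `d'` in quarter turns, counterclockwise positive
(paths which use no edge twice make no turn by two quarters). -/
def quarterTurn (d d' : Dir) : ℤ := ![0, 1, 2, -1] (d' - d)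

/-- The total turn, in quarter turns, of a path with initial direction `d`. -/
def quarterTurns : Dir → List Dir → ℤ
  | _, [] => 0
  | d, d' :: l => quarterTurn d d' + quarterTurns d' l

/-- The directions after the initial half-edge of a path in `γ` from the boundary edge `a` to
`z`: no edge is used twice and there are no crossings. -/
def IsPathIn (F : Finset Face) (γ : Finset GridEdge) (a z : GridEdge) (q : Face)
    (l : List Dir) : Prop :=
  LeadsTo γ a z q (entry F a).1 (entry F a).2 l ∧ (edgesAlong (entry F a).1 l).Nodup

open Classical in
/-- The phase `exp (-(i/2) W)`, where `W` is the winding (the total turning angle) of a path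
from `a` to `z` in the configuration. -/
noncomputable def windingPhase (F : Finset Face) (γ : Finset GridEdge) (a z : GridEdge)
    (q : Face) : ℂ :=
  if h : ∃ l, IsPathIn F γ a z q l then
    Complex.exp (-(Complex.I / 2) * ((quarterTurns (entry F a).2 h.choose : ℂ) * (Real.pi / 2)))
  else 0

/-- The critical Ising parafermionic observable `f_Ω (a, z)`, for a boundary edge `a` and an edge
`z`; the two half-edges together count as one edge. For `z = a` the path is trivial, and the sum
over the loops gives `1`. -/
noncomputable def observable (F : Finset Face) (a z : GridEdge) : ℂ :=
  if z = a then 1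
  else (∑ q ∈ ({leftFace z, rightFace z} : Finset Face).filter (· ∈ F),
    ∑ γ ∈ pathConfigs F a z q,
      (criticalWeight : ℂ) ^ (γ.card + 1) * windingPhase F γ a z q) / (partitionFunction F : ℂ)

end IsingGluing

open IsingGluing

namespace IsingGluing

/-! ### Elementary geometry of faces and edges -/

/-! Everything rests on one real-linear boundary value problem: find an s-holomorphic function whose
component along τ_ccw^(-1/2) is prescribed on the boundary. For uniqueness, the boundary integral of
Re(h²) is nonnegative (`boundary_energy`), but equals -∑|h|² when h ∥ τ_cw^(-1/2). So h vanishes on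
the boundary, and then everywhere by propagation from row to row (`eq_zero_of_boundary_eq_zero`).
Existence follows because there are as many equations as unknowns (`card_edges`). This makes the RPS
operators well defined.

If s = U₁U₂s, the extensions of s + U₂s to the two domains fit together into a solution of the
homogeneous problem on the union. It vanishes, hence so does s, and Id - U₁U₂ is invertible. For the
formula, let H be a multiple of f_Ω(x,·) and split it on the common boundary into s (in 𝓡₂) and r
(in 𝓘₂). On Ω₂ this gives r = U₂s. On Ω₁, subtracting the same multiple of f_Ω₁(x,·), with values w
on the common boundary, removes the singularity at x and gives s - w = U₁r. Hence s = Qw, and on Ω₂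
the function H is the superposition of the f_Ω₂(k,·) with coefficients s_k.

What remains is that the observable is a Green's function: s-holomorphic, equal to 1 at its source
and parallel to τ_cw^(-1/2) on the rest of the boundary. The winding is replaced by a formula
without paths, `phase`: the unit vector of the arrival direction with a sign `spin` that counts
crossings of rays from the end of the path and from the face outside the source. Moving the end
around a corner changes `phase` by half the turning angle (`phase_corner`, by means of
`IsConfig.strip`). Retracting an admissible path face by face (`phase_path`) identifies `phase` with
the winding phase of that path, whichever was chosen. The same corner moves, read as a bijection
(`swapConfig`), give s-holomorphicity; criticality enters through α = √2 - 1 = tan(π/8) in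
`cornerProj_lam`. -/

theorem side_injective (p : Face) : Function.Injective (side p) := by
  intro d d' h
  fin_cases d <;> fin_cases d' <;> simp_all [side]

theorem exists_side_eq_iff (p : Face) (e : GridEdge) :
    (∃ d, side p d = e) ↔ p = leftFace e ∨ p = rightFace e := by
  obtain ⟨x, y⟩ := p
  cases e with
  | hor a b => simp [Fin.exists_fin_succ, side, leftFace, rightFace]; omega
  | ver a b => simp [Fin.exists_fin_succ, side, leftFace, rightFace]; omega

theorem leftFace_ne_rightFace (e : GridEdge) : leftFace e ≠ rightFace e := by
  cases e <;> simp [leftFace, rightFace]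
  omega

theorem mem_edges {F : Finset Face} {e : GridEdge} :
    e ∈ edges F ↔ leftFace e ∈ F ∨ rightFace e ∈ F := by
  simp only [edges, Finset.mem_biUnion, Finset.mem_image, Finset.mem_univ, true_and,
    exists_side_eq_iff]
  constructor
  · rintro ⟨p, hp, rfl | rfl⟩ <;> simp [hp]
  · rintro (h | h)
    · exact ⟨_, h, Or.inl rfl⟩
    · exact ⟨_, h, Or.inr rfl⟩

theorem mem_interiorEdges {F : Finset Face} {e : GridEdge} :
    e ∈ interiorEdges F ↔ leftFace e ∈ F ∧ rightFace e ∈ F := by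
  simp only [interiorEdges, Finset.mem_filter, mem_edges]; tauto

theorem mem_boundaryEdges {F : Finset Face} {e : GridEdge} :
    e ∈ boundaryEdges F ↔
      (leftFace e ∈ F ∧ rightFace e ∉ F) ∨ (leftFace e ∉ F ∧ rightFace e ∈ F) := by
  simp only [boundaryEdges, Finset.mem_filter, mem_edges]; tauto

theorem boundaryEdges_subset (F : Finset Face) : boundaryEdges F ⊆ edges F :=
  Finset.filter_subset _ _

theorem side_mem_edges {F : Finset Face} {p : Face} (hp : p ∈ F) (d : Dir) :
    side p d ∈ edges F :=
  Finset.mem_biUnion.mpr ⟨p, hp, Finset.mem_image_of_mem _ (Finset.mem_univ d)⟩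

/-- A sum over the sides of all faces, reorganized as a sum over the edges. -/
theorem sum_faces_sides {M : Type*} [AddCommMonoid M] (F : Finset Face)
    (G : Face → GridEdge → M) :
    ∑ p ∈ F, ∑ d, G p (side p d) =
      ∑ e ∈ edges F, ((if leftFace e ∈ F then G (leftFace e) e else 0) +
        (if rightFace e ∈ F then G (rightFace e) e else 0)) := by
  have h₁ : ∀ p ∈ F, ∑ d, G p (side p d) = ∑ e ∈ Finset.univ.image (side p), G p e := by
    intro p _
    rw [Finset.sum_image (fun d _ d' _ h => side_injective p h)]
  have h₂ : ∀ e ∈ edges F, ((if leftFace e ∈ F then G (leftFace e) e else 0) +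
        (if rightFace e ∈ F then G (rightFace e) e else 0)) =
      ∑ p ∈ ({leftFace e, rightFace e} : Finset Face).filter (· ∈ F), G p e := by
    intro e _
    rw [Finset.sum_filter, Finset.sum_pair (leftFace_ne_rightFace e)]
  rw [Finset.sum_congr rfl h₁, Finset.sum_congr rfl h₂]
  refine Finset.sum_comm' ?_
  intro p e
  simp only [Finset.mem_image, Finset.mem_univ, true_and, exists_side_eq_iff, Finset.mem_filter,
    Finset.mem_insert, Finset.mem_singleton, mem_edges]
  constructor
  · rintro ⟨hp, rfl | rfl⟩ <;> simp [hp]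
  · tauto

theorem tauCCW_ne_zero (F : Finset Face) (e : GridEdge) : tauCCW F e ≠ 0 := by
  cases e <;> simp [tauCCW, tangent] <;> split_ifs <;> simp

theorem norm_tauCCW (F : Finset Face) (e : GridEdge) : ‖tauCCW F e‖ = 1 := by
  cases e <;> simp [tauCCW, tangent] <;> split_ifs <;> simp

/-! ### The lines of boundary values -/

/-- The unit vector that spans the line `τ_ccw^(-1/2)`. -/
noncomputable def rootCCW (F : Finset Face) (e : GridEdge) : ℂ := tauCCW F e ^ (-(1 / 2) : ℂ)

/-- The branch of the complex power matters only up to sign, so its square is all that is ever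
needed. -/
theorem cpow_neg_half_sq {τ : ℂ} (hτ : τ ≠ 0) : (τ ^ (-(1 / 2) : ℂ)) ^ 2 = τ⁻¹ := by
  rw [sq, ← Complex.cpow_add _ _ hτ, ← Complex.cpow_neg_one]
  norm_num

theorem rootCCW_sq_mul (F : Finset Face) (e : GridEdge) : rootCCW F e ^ 2 * tauCCW F e = 1 := by
  rw [rootCCW, cpow_neg_half_sq (tauCCW_ne_zero F e), inv_mul_cancel₀ (tauCCW_ne_zero F e)]

theorem normSq_rootCCW (F : Finset Face) (e : GridEdge) : Complex.normSq (rootCCW F e) = 1 := by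
  have h := congrArg norm (rootCCW_sq_mul F e)
  rw [norm_mul, norm_pow, norm_tauCCW, mul_one, norm_one] at h
  rw [Complex.normSq_eq_norm_sq, h]

theorem rootCCW_ne_zero (F : Finset Face) (e : GridEdge) : rootCCW F e ≠ 0 := by
  intro h
  simpa [h] using normSq_rootCCW F e

theorem mem_rootLine_tauCCW {F : Finset Face} {e : GridEdge} {x : ℂ} :
    x ∈ rootLine (tauCCW F e) ↔ ∃ r : ℝ, (r : ℂ) * rootCCW F e = x := by
  simp [rootLine, Submodule.mem_span_singleton, rootCCW]

/-- Since τ_cw = -τ_ccw, the two roots differ by a factor ±i, and the sign does not affect a real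
line. -/
theorem mem_rootLine_tauCW {F : Finset Face} {e : GridEdge} {x : ℂ} :
    x ∈ rootLine (tauCW F e) ↔ ∃ r : ℝ, (r : ℂ) * (Complex.I * rootCCW F e) = x := by
  have h : ((tauCW F e) ^ (-(1 / 2) : ℂ)) ^ 2 = (Complex.I * rootCCW F e) ^ 2 := by
    rw [cpow_neg_half_sq (by simp [tauCW, tauCCW_ne_zero]), mul_pow, Complex.I_sq, rootCCW,
      cpow_neg_half_sq (tauCCW_ne_zero F e), tauCW, inv_neg]
    ring
  rcases sq_eq_sq_iff_eq_or_eq_neg.mp h with h | h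
  · simp only [rootLine, Submodule.mem_span_singleton, h, Complex.real_smul]
  · simp only [rootLine, Submodule.mem_span_singleton, h]
    constructor
    · rintro ⟨r, rfl⟩; exact ⟨-r, by simp⟩
    · rintro ⟨r, rfl⟩; exact ⟨-r, by simp⟩

/-- The coordinate along `τ_ccw^(-1/2)`. -/
noncomputable def realPart (F : Finset Face) (e : GridEdge) : ℂ →ₗ[ℝ] ℝ where
  toFun x := (x * star (rootCCW F e)).re
  map_add' x y := by rw [add_mul, Complex.add_re]
  map_smul' r x := by simp [mul_assoc]

theorem realPart_apply (F : Finset Face) (e : GridEdge) (x : ℂ) :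
    realPart F e x = (x * star (rootCCW F e)).re := rfl

theorem realPart_mul_rootCCW (F : Finset Face) (e : GridEdge) (r : ℝ) :
    realPart F e (r * rootCCW F e) = r := by
  have h : rootCCW F e * star (rootCCW F e) = 1 := by
    rw [← Complex.ofReal_one, ← normSq_rootCCW F e]; exact Complex.mul_conj _
  rw [realPart_apply, mul_assoc, h]; simp

/-- The lines for τ_cw and τ_ccw are orthogonal, so each boundary condition becomes a single real
equation. -/
theorem mem_rootLine_tauCW_iff {F : Finset Face} {e : GridEdge} {x : ℂ} :
    x ∈ rootLine (tauCW F e) ↔ realPart F e x = 0 := by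
  have h : rootCCW F e * star (rootCCW F e) = 1 := by
    rw [← Complex.ofReal_one, ← normSq_rootCCW F e]; exact Complex.mul_conj _
  rw [mem_rootLine_tauCW]
  constructor
  · rintro ⟨r, rfl⟩
    have : (r : ℂ) * (Complex.I * rootCCW F e) * star (rootCCW F e) = r * Complex.I := by
      linear_combination (r * Complex.I) * h
    rw [realPart_apply, this]; simp
  · intro hx
    refine ⟨(x * star (rootCCW F e)).im, ?_⟩
    have h₂ : ((x * star (rootCCW F e)).im : ℂ) * Complex.I = x * star (rootCCW F e) := by
      apply Complex.ext
      · simpa [realPart_apply] using hx.symm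
      · simp
    rw [← mul_assoc, h₂, mul_assoc, mul_comm (star _), h, mul_one]

theorem sub_realPart_mem (F : Finset Face) (e : GridEdge) (x : ℂ) :
    x - realPart F e x * rootCCW F e ∈ rootLine (tauCW F e) := by
  rw [mem_rootLine_tauCW_iff, map_sub, realPart_mul_rootCCW, sub_self]

theorem realPart_mul_of_mem {F : Finset Face} {e : GridEdge} {x : ℂ}
    (hx : x ∈ rootLine (tauCCW F e)) : (realPart F e x : ℂ) * rootCCW F e = x := by
  obtain ⟨r, rfl⟩ := mem_rootLine_tauCCW.mp hx
  rw [realPart_mul_rootCCW]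

theorem eq_zero_of_mem_of_mem {F : Finset Face} {e : GridEdge} {x : ℂ}
    (h₁ : x ∈ rootLine (tauCCW F e)) (h₂ : x ∈ rootLine (tauCW F e)) : x = 0 := by
  rw [← realPart_mul_of_mem h₁, mem_rootLine_tauCW_iff.mp h₂]; simp

/-- This is the sign that opposes `boundary_energy` and yields uniqueness. -/
theorem re_sq_mul_of_mem_tauCW {F : Finset Face} {e : GridEdge} {x : ℂ}
    (hx : x ∈ rootLine (tauCW F e)) : (x ^ 2 * tauCCW F e).re = -Complex.normSq x := by
  obtain ⟨r, rfl⟩ := mem_rootLine_tauCW.mp hx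
  have : ((r : ℂ) * (Complex.I * rootCCW F e)) ^ 2 * tauCCW F e = ((-r ^ 2 : ℝ) : ℂ) := by
    push_cast
    linear_combination (-r ^ 2 : ℂ) * rootCCW_sq_mul F e +
      ((r : ℂ) ^ 2 * rootCCW F e ^ 2 * tauCCW F e) * Complex.I_sq
  rw [this, Complex.ofReal_re]
  simp [normSq_rootCCW, sq]

/-! ### S-holomorphicity in real coordinates -/

theorem lam_eq : lam = ⟨√2 / 2, √2 / 2⟩ := by
  rw [lam, show Complex.I * Real.pi / 4 = ((Real.pi / 4 : ℝ) : ℂ) * Complex.I by push_cast; ring,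
    Complex.exp_mul_I, ← Complex.ofReal_cos, ← Complex.ofReal_sin, Real.cos_pi_div_four,
    Real.sin_pi_div_four]
  apply Complex.ext <;> simp

theorem half_sqrt_two_sq : (√2 / 2) ^ 2 = (1 / 2 : ℝ) := by
  rw [div_pow, Real.sq_sqrt (by norm_num)]; norm_num

theorem lam_inv_eq : lam⁻¹ = ⟨√2 / 2, -(√2 / 2)⟩ := by
  have := half_sqrt_two_sq
  rw [inv_eq_iff_eq_inv, eq_comm, inv_eq_of_mul_eq_one_left]
  rw [lam_eq]
  apply Complex.ext <;> simp <;> nlinarith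

theorem lam_cube_eq : lam ^ 3 = ⟨-(√2 / 2), √2 / 2⟩ := by
  have := half_sqrt_two_sq
  rw [lam_eq, pow_succ, sq]
  generalize √2 / 2 = σ at *
  apply Complex.ext
  · simp only [Complex.mul_re, Complex.mul_im]
    linear_combination (-2 * σ) * this
  · simp only [Complex.mul_re, Complex.mul_im]
    linear_combination (2 * σ) * this

theorem lam_cube_inv_eq : (lam ^ 3)⁻¹ = ⟨-(√2 / 2), -(√2 / 2)⟩ := by
  have := half_sqrt_two_sq
  rw [inv_eq_iff_eq_inv, eq_comm, inv_eq_of_mul_eq_one_left]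
  rw [lam_cube_eq]
  apply Complex.ext <;> simp <;> nlinarith

/-- The map x ↦ x + μx̄ has real rank one: multiplied by 1 + μ̄ it becomes twice a real part. Each
corner thus imposes one real condition, as the dimension count requires. -/
theorem add_mul_star_eq_iff {μ : ℂ} (h₁ : μ * star μ = 1) (h₂ : 1 + μ ≠ 0) (x y : ℂ) :
    x + μ * star x = y + μ * star y ↔ ((1 + star μ) * (x - y)).re = 0 := by
  have key : ((x + μ * star x) - (y + μ * star y)) * (1 + star μ) =
      ((2 * ((1 + star μ) * (x - y)).re : ℝ) : ℂ) := by
    have := Complex.add_conj ((1 + star μ) * (x - y))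
    rw [← this]
    simp only [Complex.star_def, map_mul, map_add, map_sub, map_one, Complex.conj_conj] at h₁ ⊢
    linear_combination ((starRingEnd ℂ) x - (starRingEnd ℂ) y) * h₁
  have h₃ : 1 + star μ ≠ 0 := by
    intro h
    apply h₂
    have := congrArg star h
    simpa using this
  rw [← sub_eq_zero, ← mul_eq_zero_iff_right h₃, key, Complex.ofReal_eq_zero]
  constructor <;> intro h <;> linarith

/-- The four directions of adjacent sides of a face and the constant of their common corner. -/
noncomputable def corner : Fin 4 → Dir × Dir × ℂ :=
  ![(1, 0, lam), (1, 2, lam⁻¹), (3, 0, lam ^ 3), (3, 2, (lam ^ 3)⁻¹)]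

theorem corner_eq : corner = ![(1, 0, ⟨√2 / 2, √2 / 2⟩), (1, 2, ⟨√2 / 2, -(√2 / 2)⟩),
    (3, 0, ⟨-(√2 / 2), √2 / 2⟩), (3, 2, ⟨-(√2 / 2), -(√2 / 2)⟩)] := by
  rw [corner, lam_cube_inv_eq, lam_inv_eq, lam_cube_eq, lam_eq]

theorem corner_unit (k : Fin 4) : (corner k).2.2 * star (corner k).2.2 = 1 := by
  have := half_sqrt_two_sq
  fin_cases k <;>
    simp only [corner_eq] <;> apply Complex.ext <;> simp <;> nlinarith

theorem one_add_corner_ne_zero (k : Fin 4) : 1 + (corner k).2.2 ≠ 0 := by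
  have h : √2 ≠ 0 := by positivity
  intro hk
  have hk := congrArg Complex.im hk
  revert hk
  fin_cases k <;>
    simp [corner_eq]

theorem sHolomorphic_iff_corner {F : Finset Face} {h : GridEdge → ℂ} :
    SHolomorphic F h ↔ ∀ p ∈ F, ∀ k,
      h (side p (corner k).1) + (corner k).2.2 * star (h (side p (corner k).1)) =
        h (side p (corner k).2.1) + (corner k).2.2 * star (h (side p (corner k).2.1)) := by
  simp [SHolomorphic, corner, Fin.forall_fin_succ]

/-- The defect of s-holomorphicity at the corner `k` of the face `p`. -/
noncomputable def defect (p : Face) (k : Fin 4) : (GridEdge → ℂ) →ₗ[ℝ] ℝ where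
  toFun h := ((1 + star (corner k).2.2) *
    (h (side p (corner k).1) - h (side p (corner k).2.1))).re
  map_add' x y := by
    rw [← Complex.add_re, ← mul_add]; congr 2; simp only [Pi.add_apply]; ring
  map_smul' r x := by
    simp only [Pi.smul_apply, ← smul_sub, mul_smul_comm, Complex.smul_re, RingHom.id_apply]

theorem sHolomorphic_iff_defect {F : Finset Face} {h : GridEdge → ℂ} :
    SHolomorphic F h ↔ ∀ p ∈ F, ∀ k, defect p k h = 0 := by
  rw [sHolomorphic_iff_corner]
  refine forall₂_congr fun p _ => forall_congr' fun k => ?_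
  exact add_mul_star_eq_iff (corner_unit k) (one_add_corner_ne_zero k) _ _

theorem sHolomorphic_iff_real {F : Finset Face} {h : GridEdge → ℂ} :
    SHolomorphic F h ↔ ∀ p ∈ F,
      (1 + √2 / 2) * ((h (side p 1)).re - (h (side p 0)).re) +
        √2 / 2 * ((h (side p 1)).im - (h (side p 0)).im) = 0 ∧
      (1 + √2 / 2) * ((h (side p 1)).re - (h (side p 2)).re) -
        √2 / 2 * ((h (side p 1)).im - (h (side p 2)).im) = 0 ∧
      (1 - √2 / 2) * ((h (side p 3)).re - (h (side p 0)).re) +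
        √2 / 2 * ((h (side p 3)).im - (h (side p 0)).im) = 0 ∧
      (1 - √2 / 2) * ((h (side p 3)).re - (h (side p 2)).re) -
        √2 / 2 * ((h (side p 3)).im - (h (side p 2)).im) = 0 := by
  rw [sHolomorphic_iff_defect]
  refine forall₂_congr fun p _ => ?_
  simp only [Fin.forall_fin_succ, defect, LinearMap.coe_mk, AddHom.coe_mk, corner_eq]
  simp [sub_eq_add_neg]

namespace SHolomorphic

variable {F G : Finset Face} {h k : GridEdge → ℂ}

theorem add (hh : SHolomorphic F h) (hk : SHolomorphic F k) : SHolomorphic F (h + k) := by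
  rw [sHolomorphic_iff_defect] at *
  intro p hp i
  rw [map_add, hh p hp i, hk p hp i, add_zero]

theorem smul (r : ℝ) (hh : SHolomorphic F h) : SHolomorphic F (r • h) := by
  rw [sHolomorphic_iff_defect] at *
  intro p hp i
  rw [map_smul, hh p hp i, smul_zero]

theorem sub (hh : SHolomorphic F h) (hk : SHolomorphic F k) : SHolomorphic F (h - k) := by
  rw [sHolomorphic_iff_defect] at *
  intro p hp i
  rw [map_sub, hh p hp i, hk p hp i, sub_zero]

theorem sum {ι : Type*} {s : Finset ι} {f : ι → GridEdge → ℂ}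
    (hf : ∀ i ∈ s, SHolomorphic F (f i)) : SHolomorphic F (∑ i ∈ s, f i) := by
  rw [sHolomorphic_iff_defect]
  intro p hp i
  rw [map_sum]
  exact Finset.sum_eq_zero fun j hj => sHolomorphic_iff_defect.mp (hf j hj) p hp i

theorem mono (hFG : F ⊆ G) (hh : SHolomorphic G h) : SHolomorphic F h :=
  fun p hp => hh p (hFG hp)

theorem congr (hh : SHolomorphic F h) (hk : ∀ e ∈ edges F, h e = k e) : SHolomorphic F k := by
  intro p hp
  rw [← hk _ (side_mem_edges hp 0), ← hk _ (side_mem_edges hp 1), ← hk _ (side_mem_edges hp 2),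
    ← hk _ (side_mem_edges hp 3)]
  exact hh p hp

end SHolomorphic

/-- The discrete integral of `Re (h²)` around a face is nonnegative. -/
theorem face_energy {F : Finset Face} {h : GridEdge → ℂ} (hh : SHolomorphic F h) {p : Face}
    (hp : p ∈ F) :
    0 ≤ (h (side p 0) ^ 2 * Complex.I).re + (h (side p 1) ^ 2 * (-1)).re +
      (h (side p 2) ^ 2 * (-Complex.I)).re + (h (side p 3) ^ 2 * 1).re := by
  obtain ⟨a, b, c, d⟩ := sHolomorphic_iff_real.mp hh p hp
  have hs := half_sqrt_two_sq
  have hs0 : 0 ≤ √2 / 2 := by positivity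
  generalize h (side p 0) = e at *
  generalize h (side p 1) = n at *
  generalize h (side p 2) = w at *
  generalize h (side p 3) = s at *
  obtain ⟨e1, e2⟩ := e
  obtain ⟨n1, n2⟩ := n
  obtain ⟨w1, w2⟩ := w
  obtain ⟨s1, s2⟩ := s
  simp only [sq, Complex.mul_re, Complex.mul_im, Complex.I_re, Complex.I_im, Complex.neg_re,
    Complex.neg_im, Complex.one_re, Complex.one_im] at *
  generalize √2 / 2 = σ at *
  -- The corner equations determine E and W from N and S. Subtracting the two equations at a
  -- vertical side leaves 2σ times its real part, and 1/(2σ) = σ.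
  have he1 : e1 = σ * ((1 + σ) * n1 + σ * n2 - (1 - σ) * s1 - σ * s2) := by
    linear_combination (-2 * e1) * hs - σ * a + σ * c
  have he2 : e2 = 2 * σ * ((1 + σ) * n1 + σ * n2 - (1 + σ) * e1) := by
    linear_combination (-2 * e2) * hs - 2 * σ * a
  have hw1 : w1 = σ * ((1 + σ) * n1 - σ * n2 - (1 - σ) * s1 + σ * s2) := by
    linear_combination (-2 * w1) * hs - σ * b + σ * d
  have hw2 : w2 = 2 * σ * ((1 + σ) * w1 - (1 + σ) * n1 + σ * n2) := by
    linear_combination (-2 * w2) * hs + 2 * σ * b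
  -- The energy of the face is √2 |N - S|², once powers of σ are reduced by σ² = 1/2.
  have key : -2 * (e1 * e2) + (n2 * n2 - n1 * n1) + 2 * (w1 * w2) + (s1 * s1 - s2 * s2) =
      2 * σ * ((n1 - s1) ^ 2 + (n2 - s2) ^ 2) := by
    have hs2 : σ ^ 2 = 1 / 2 := by rw [sq, hs]
    have h3 : σ ^ 3 = σ / 2 := by linear_combination σ * hs
    have h4 : σ ^ 4 = 1 / 4 := by linear_combination (σ ^ 2 + 1 / 2) * hs
    have h5 : σ ^ 5 = σ / 4 := by linear_combination σ * h4
    have h6 : σ ^ 6 = 1 / 8 := by linear_combination σ ^ 2 * h4 + hs / 4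
    rw [he2, hw2, he1, hw1]
    ring_nf
    simp only [hs2, h3, h4, h5, h6]
    ring
  have : 0 ≤ 2 * σ * ((n1 - s1) ^ 2 + (n2 - s2) ^ 2) := by positivity
  linarith

/-- The signed contributions of the faces to the boundary integral of `Re (h²)`. -/
theorem boundary_energy {F : Finset Face} {h : GridEdge → ℂ} (hh : SHolomorphic F h) :
    0 ≤ ∑ e ∈ boundaryEdges F, (h e ^ 2 * tauCCW F e).re := by
  have h₁ : 0 ≤ ∑ p ∈ F, ∑ d, (h (side p d) ^ 2 *
      (if p = leftFace (side p d) then tangent (side p d) else -tangent (side p d))).re := by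
    refine Finset.sum_nonneg fun p hp => ?_
    have := face_energy hh hp
    rw [Fin.sum_univ_four]
    have e0 : ¬ (p = leftFace (side p 1)) := by simp [side, leftFace, Prod.ext_iff]
    have e1 : ¬ (p = leftFace (side p 2)) := by simp [side, leftFace, Prod.ext_iff]; omega
    have e2 : p = leftFace (side p 0) := by simp [side, leftFace]
    have e3 : p = leftFace (side p 3) := by simp [side, leftFace]
    rw [if_neg e0, if_neg e1, if_pos e2, if_pos e3]
    simpa [side, tangent] using this
  rw [sum_faces_sides F (fun p e => (h e ^ 2 *
      (if p = leftFace e then tangent e else -tangent e)).re)] at h₁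
  refine h₁.trans_eq ?_
  rw [boundaryEdges, Finset.sum_filter]
  refine Finset.sum_congr rfl fun e he => ?_
  have := mem_edges.mp he
  have hne := (leftFace_ne_rightFace e).symm
  by_cases hl : leftFace e ∈ F <;> by_cases hr : rightFace e ∈ F
  -- An interior edge is traversed in opposite directions by its two faces, so its contributions
  -- cancel.
  · simp [hl, hr, hne]
  · simp [hl, hr, tauCCW]
  · simp [hl, hr, hne, tauCCW]
  · tauto

/-- Under this condition the nonnegative boundary integral equals -∑|h|², which forces every term to
vanish. -/
theorem eq_zero_on_boundary {F : Finset Face} {h : GridEdge → ℂ} (hh : SHolomorphic F h)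
    (hb : ∀ e ∈ boundaryEdges F, h e ∈ rootLine (tauCW F e)) :
    ∀ e ∈ boundaryEdges F, h e = 0 := by
  have h₁ := boundary_energy hh
  rw [Finset.sum_congr rfl fun e he => re_sq_mul_of_mem_tauCW (hb e he),
    Finset.sum_neg_distrib, neg_nonneg] at h₁
  have h₂ := (Finset.sum_eq_zero_iff_of_nonneg fun e _ => Complex.normSq_nonneg (h e)).mp
    (le_antisymm h₁ (Finset.sum_nonneg fun e _ => Complex.normSq_nonneg (h e)))
  exact fun e he => Complex.normSq_eq_zero.mp (h₂ e he)

/-- An s-holomorphic function that vanishes on the boundary edges vanishes. -/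
theorem eq_zero_of_boundary_eq_zero {F : Finset Face} {h : GridEdge → ℂ}
    (hh : SHolomorphic F h) (hb : ∀ e ∈ boundaryEdges F, h e = 0) :
    ∀ e ∈ edges F, h e = 0 := by
  have hs := half_sqrt_two_sq
  have hs0 : √2 / 2 ≠ 0 := by positivity
  have hreal := sHolomorphic_iff_real.mp hh
  generalize √2 / 2 = σ at *
  -- two adjacent faces of a row with vanishing south sides
  have hver : ∀ x y, (∀ x, GridEdge.hor x y ∈ edges F → h (.hor x y) = 0) →
      GridEdge.ver x y ∈ edges F → h (.ver x y) = 0 := by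
    intro x y hrow he
    by_cases hbd : GridEdge.ver x y ∈ boundaryEdges F
    · exact hb _ hbd
    have h₁ : ((x - 1, y) : Face) ∈ F ∧ ((x, y) : Face) ∈ F := by
      have a := mem_edges.mp he
      have b := mt mem_boundaryEdges.mpr hbd
      simp only [leftFace, rightFace] at a b
      tauto
    -- The south-east equation of the left face and the south-west equation of the right face are
    -- independent: their sum isolates the real part, their difference the imaginary part.
    obtain ⟨-, -, a, -⟩ := hreal _ h₁.1
    obtain ⟨-, -, -, b⟩ := hreal _ h₁.2
    have z₁ := hrow (x - 1) (side_mem_edges h₁.1 3)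
    have z₂ := hrow x (side_mem_edges h₁.2 3)
    simp only [side, z₁, z₂, sub_add_cancel, Complex.zero_re, Complex.zero_im] at a b
    have hm : (h (.ver x y)).im = 0 := by
      have : σ * (h (.ver x y)).im = 0 := by linear_combination (b - a) / 2
      exact (mul_eq_zero.mp this).resolve_left hs0
    have hσ : 1 - σ ≠ 0 := by
      intro h1
      have : σ = 1 := by linarith
      rw [this] at hs; norm_num at hs
    have hr : (h (.ver x y)).re = 0 := by
      have : (1 - σ) * (h (.ver x y)).re = 0 := by linear_combination -(a + b) / 2
      exact (mul_eq_zero.mp this).resolve_left hσ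
    exact Complex.ext hr hm
  have hup : ∀ x y, (∀ x, GridEdge.hor x y ∈ edges F → h (.hor x y) = 0) →
      ((x, y) : Face) ∈ F → h (.hor x (y + 1)) = 0 := by
    intro x y hrow hp
    obtain ⟨a, b, -, -⟩ := hreal _ hp
    have z₁ := hver _ _ hrow (side_mem_edges hp 0)
    have z₂ := hver _ _ hrow (side_mem_edges hp 2)
    simp only [side, z₁, z₂, Complex.zero_re, Complex.zero_im] at a b
    have hm : (h (.hor x (y + 1))).im = 0 := by
      have : σ * (h (.hor x (y + 1))).im = 0 := by linear_combination (a - b) / 2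
      exact (mul_eq_zero.mp this).resolve_left hs0
    have hσ : 1 + σ ≠ 0 := by
      intro h1
      have : σ = -1 := by linarith
      rw [this] at hs; norm_num at hs
    have hr : (h (.hor x (y + 1))).re = 0 := by
      have : (1 + σ) * (h (.hor x (y + 1))).re = 0 := by linear_combination (a + b) / 2
      exact (mul_eq_zero.mp this).resolve_left hσ
    exact Complex.ext hr hm
  -- Below the lowest row there are no faces, so the horizontal edges at its bottom are boundary
  -- edges and start the induction.
  obtain ⟨m, hm⟩ : ∃ m : ℤ, ∀ p ∈ F, m ≤ p.2 := by
    obtain ⟨m, hm⟩ := (F.image Prod.snd).bddBelow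
    exact ⟨m, fun p hp => hm (by simpa using ⟨p.1, hp⟩)⟩
  have hhor : ∀ n : ℕ, ∀ x, GridEdge.hor x (m + n) ∈ edges F → h (.hor x (m + n)) = 0 := by
    intro n
    induction n with
    | zero =>
      intro x he
      refine hb _ (mem_boundaryEdges.mpr ?_)
      have a := mem_edges.mp he
      simp only [leftFace, rightFace, Nat.cast_zero, add_zero] at a ⊢
      have : ((x, m - 1) : Face) ∉ F := fun h => by have := hm _ h; simp at this
      tauto
    | succ n ih =>
      intro x he
      by_cases hp : ((x, m + n) : Face) ∈ F
      · have := hup _ _ ih hp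
        rwa [Nat.cast_succ, ← add_assoc]
      · refine hb _ (mem_boundaryEdges.mpr ?_)
        have a := mem_edges.mp he
        simp only [leftFace, rightFace, Nat.cast_succ, ← add_assoc, add_sub_cancel_right] at a ⊢
        tauto
  have hhor' : ∀ y x, GridEdge.hor x y ∈ edges F → h (.hor x y) = 0 := by
    intro y x he
    have : m ≤ y := by
      rcases mem_edges.mp he with h | h
      · exact hm _ h
      · have := hm _ h; simp [rightFace] at this; omega
    have h := hhor (y - m).toNat x
    rw [Int.toNat_of_nonneg (by omega), add_sub_cancel] at h
    exact h he
  rintro (⟨x, y⟩ | ⟨x, y⟩) he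
  · exact hhor' y x he
  · exact hver x y (hhor' y) he

theorem eq_zero_of_realPart_eq_zero {F : Finset Face} {h : GridEdge → ℂ}
    (hh : SHolomorphic F h) (hb : ∀ e ∈ boundaryEdges F, realPart F e (h e) = 0) :
    ∀ e ∈ edges F, h e = 0 :=
  eq_zero_of_boundary_eq_zero hh
    (eq_zero_on_boundary hh fun e he => mem_rootLine_tauCW_iff.mpr (hb e he))

theorem eq_of_realPart_eq {F : Finset Face} {h k : GridEdge → ℂ}
    (hh : SHolomorphic F h) (hk : SHolomorphic F k)
    (hb : ∀ e ∈ boundaryEdges F, realPart F e (h e) = realPart F e (k e)) :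
    ∀ e ∈ edges F, h e = k e := by
  intro e he
  refine sub_eq_zero.mp (eq_zero_of_realPart_eq_zero (hh.sub hk) (fun e he => ?_) e he)
  rw [Pi.sub_apply, map_sub, hb e he, sub_self]

/-! ### The boundary value problem -/

/-- Count pairs of a face and a side: interior edges occur twice, boundary edges once. The left side
is the number of real unknowns; the right side counts one equation per corner and one per boundary
edge. -/
theorem card_edges (F : Finset Face) :
    2 * (edges F).card = 4 * F.card + (boundaryEdges F).card := by
  have h := sum_faces_sides F (fun _ _ => 1)
  simp only [Finset.sum_const, Finset.card_univ, Fintype.card_fin, smul_eq_mul, mul_one] at h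
  have h₂ : ∑ e ∈ edges F, ((if leftFace e ∈ F then 1 else 0) +
      (if rightFace e ∈ F then 1 else 0)) + (boundaryEdges F).card = ∑ e ∈ edges F, 2 := by
    rw [boundaryEdges, Finset.card_filter, ← Finset.sum_add_distrib]
    refine Finset.sum_congr rfl fun e he => ?_
    have := mem_edges.mp he
    by_cases hl : leftFace e ∈ F <;> by_cases hr : rightFace e ∈ F <;> simp_all
  rw [← h, Finset.sum_const, smul_eq_mul] at h₂
  omega

/-- Extension by zero of a function on the edges of a domain. -/
noncomputable def extendEdges (F : Finset Face) : (edges F → ℂ) →ₗ[ℝ] (GridEdge → ℂ) where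
  toFun g e := if he : e ∈ edges F then g ⟨e, he⟩ else 0
  map_add' g k := by funext e; by_cases he : e ∈ edges F <;> simp [he]
  map_smul' r g := by funext e; by_cases he : e ∈ edges F <;> simp [he]

theorem extendEdges_apply {F : Finset Face} (g : edges F → ℂ) (e : edges F) :
    extendEdges F g e = g e := by
  simp [extendEdges]

/-- The linear map whose values are the defects of s-holomorphicity and the coordinates along
`τ_ccw^(-1/2)` on the boundary. -/
noncomputable def boundaryProblem (F : Finset Face) :
    (edges F → ℂ) →ₗ[ℝ] (F × Fin 4 → ℝ) × (boundaryEdges F → ℝ) :=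
  (LinearMap.prod (LinearMap.pi fun i : F × Fin 4 => defect i.1 i.2)
    (LinearMap.pi fun e : boundaryEdges F => realPart F e ∘ₗ LinearMap.proj (e : GridEdge))) ∘ₗ
    extendEdges F

theorem sHolomorphic_extendEdges {F : Finset Face} {g : edges F → ℂ}
    (hg : (boundaryProblem F g).1 = 0) : SHolomorphic F (extendEdges F g) :=
  sHolomorphic_iff_defect.mpr fun p hp k => congrFun hg (⟨p, hp⟩, k)

theorem boundaryProblem_injective (F : Finset Face) :
    Function.Injective (boundaryProblem F) := by
  rw [← LinearMap.ker_eq_bot, LinearMap.ker_eq_bot']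
  intro g hg
  have h := eq_zero_of_realPart_eq_zero (sHolomorphic_extendEdges (congrArg Prod.fst hg))
    fun e he => congrFun (congrArg Prod.snd hg) ⟨e, he⟩
  funext e
  rw [← extendEdges_apply g e]
  exact h e e.2

/-- Injectivity suffices, because both sides have the same real dimension. -/
theorem boundaryProblem_surjective (F : Finset Face) :
    Function.Surjective (boundaryProblem F) := by
  refine (LinearMap.injective_iff_surjective_of_finrank_eq_finrank ?_).mp
    (boundaryProblem_injective F)
  simp [Module.finrank_pi_fintype, Module.finrank_prod]
  have := card_edges F
  omega

theorem exists_sHolomorphic (F : Finset Face) (r : GridEdge → ℝ) :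
    ∃ h : GridEdge → ℂ, SHolomorphic F h ∧ ∀ e ∈ boundaryEdges F, realPart F e (h e) = r e := by
  obtain ⟨g, hg⟩ := boundaryProblem_surjective F (0, fun e => r e)
  exact ⟨extendEdges F g, sHolomorphic_extendEdges (congrArg Prod.fst hg),
    fun e he => congrFun (congrArg Prod.snd hg) ⟨e, he⟩⟩

/-! ### The RPS operators -/

section Rps

variable {F : Finset Face} {b : Finset GridEdge}

theorem dataR_mem (u : dataR F b) (e : b) : (u : b → ℂ) e ∈ rootLine (tauCCW F e) :=
  u.2 e (Set.mem_univ e)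

theorem dataI_mem (v : dataI F b) (e : b) : (v : b → ℂ) e ∈ rootLine (tauCW F e) :=
  v.2 e (Set.mem_univ e)

theorem mem_dataR {f : b → ℂ} : f ∈ dataR F b ↔ ∀ e : b, f e ∈ rootLine (tauCCW F e) := by
  simp [dataR, Submodule.mem_pi]

theorem mem_dataI {f : b → ℂ} : f ∈ dataI F b ↔ ∀ e : b, f e ∈ rootLine (tauCW F e) := by
  simp [dataI, Submodule.mem_pi]

theorem HasSHolExtension.add {u u' : dataR F b} {v v' : dataI F b}
    (h : HasSHolExtension F b u v) (h' : HasSHolExtension F b u' v') :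
    HasSHolExtension F b (u + u') (v + v') := by
  obtain ⟨k, h₁, h₂, h₃⟩ := h
  obtain ⟨k', h₁', h₂', h₃'⟩ := h'
  refine ⟨k + k', h₁.add h₁', fun e => ?_, fun e he => Submodule.add_mem _ (h₃ e he) (h₃' e he)⟩
  simp only [Pi.add_apply, h₂, h₂', Submodule.coe_add]
  ring

theorem HasSHolExtension.smul {u : dataR F b} {v : dataI F b} (r : ℝ)
    (h : HasSHolExtension F b u v) : HasSHolExtension F b (r • u) (r • v) := by
  obtain ⟨k, h₁, h₂, h₃⟩ := h
  refine ⟨r • k, h₁.smul r, fun e => ?_, fun e he => Submodule.smul_mem _ _ (h₃ e he)⟩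
  simp only [Pi.smul_apply, h₂, Submodule.coe_smul, smul_add]

/-- On `b` the component along τ_ccw^(-1/2) comes from u alone, and on the rest of the boundary it
is zero; so the extension does not depend on v. -/
theorem HasSHolExtension.unique (hb : b ⊆ boundaryEdges F) {u : dataR F b} {v v' : dataI F b}
    (h : HasSHolExtension F b u v) (h' : HasSHolExtension F b u v') : v = v' := by
  obtain ⟨k, h₁, h₂, h₃⟩ := h
  obtain ⟨k', h₁', h₂', h₃'⟩ := h'
  have key : ∀ e ∈ edges F, k e = k' e := by
    refine eq_of_realPart_eq h₁ h₁' fun e he => ?_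
    by_cases heb : e ∈ b
    · have a := h₂ ⟨e, heb⟩
      have a' := h₂' ⟨e, heb⟩
      simp only at a a'
      rw [a, a', map_add, map_add, mem_rootLine_tauCW_iff.mp (dataI_mem v ⟨e, heb⟩),
        mem_rootLine_tauCW_iff.mp (dataI_mem v' ⟨e, heb⟩)]
    · have hm : e ∈ boundaryEdges F \ b := Finset.mem_sdiff.mpr ⟨he, heb⟩
      rw [mem_rootLine_tauCW_iff.mp (h₃ e hm), mem_rootLine_tauCW_iff.mp (h₃' e hm)]
  apply Subtype.ext
  funext e
  have := key e (boundaryEdges_subset F (hb e.2))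
  rw [h₂, h₂'] at this
  exact add_left_cancel this

/-- Solve the boundary value problem with the coordinates of u on `b` and zero elsewhere; v is what
is left of the solution on `b`. -/
theorem exists_hasSHolExtension (hb : b ⊆ boundaryEdges F) (u : dataR F b) :
    ∃ v, HasSHolExtension F b u v := by
  obtain ⟨h, h₁, h₂⟩ := exists_sHolomorphic F
    (fun e => if he : e ∈ b then realPart F e ((u : b → ℂ) ⟨e, he⟩) else 0)
  refine ⟨⟨fun e => h e - (u : b → ℂ) e, mem_dataI.mpr fun e => ?_⟩, h, h₁, fun e => ?_,
    fun e he => ?_⟩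
  · rw [mem_rootLine_tauCW_iff, map_sub, h₂ e (hb e.2), dif_pos e.2, sub_self]
  · simp
  · obtain ⟨he, heb⟩ := Finset.mem_sdiff.mp he
    rw [mem_rootLine_tauCW_iff, h₂ e he, dif_neg heb]

/-- Uniqueness makes the pointwise choice of v additive and homogeneous, so the linear map sought in
`rps` exists. -/
theorem hasSHolExtension_rps (hb : b ⊆ boundaryEdges F) (u : dataR F b) :
    HasSHolExtension F b u (rps F b u) := by
  have h : ∃ U : dataR F b →ₗ[ℝ] dataI F b, ∀ u, HasSHolExtension F b u (U u) := by
    choose U hU using exists_hasSHolExtension hb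
    exact ⟨{ toFun := U
             map_add' := fun u u' => (hU _).unique hb ((hU u).add (hU u'))
             map_smul' := fun r u => (hU _).unique hb ((hU u).smul r) }, hU⟩
  rw [rps, dif_pos h]
  exact h.choose_spec u

theorem hasSHolExtension_iff (hb : b ⊆ boundaryEdges F) (u : dataR F b) (v : dataI F b) :
    HasSHolExtension F b u v ↔ v = rps F b u := by
  constructor
  · exact fun h => h.unique hb (hasSHolExtension_rps hb u)
  · rintro rfl
    exact hasSHolExtension_rps hb u

/-- The Cauchy data space spans `b → ℂ`, so that a real operator has exactly one matrix. -/
theorem existsUnique_isMatrixOf (Q : Module.End ℝ (dataR F b)) : ∃! M, IsMatrixOf Q M := by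
  classical
  have hs : ∀ k : b, Pi.single k (rootCCW F k) ∈ dataR F b := by
    intro k
    refine mem_dataR.mpr fun e => ?_
    by_cases h : e = k
    · subst h
      rw [Pi.single_eq_same]
      exact mem_rootLine_tauCCW.mpr ⟨1, by simp⟩
    · rw [Pi.single_eq_of_ne h]
      exact Submodule.zero_mem _
  let β : b → dataR F b := fun k => ⟨_, hs k⟩
  have hu : ∀ u : dataR F b, u = ∑ k : b, realPart F k ((u : b → ℂ) k) • β k := by
    intro u
    apply Subtype.ext
    funext e
    rw [Submodule.coe_sum, Finset.sum_apply, Finset.sum_eq_single e]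
    · simp [β, realPart_mul_of_mem (dataR_mem u e)]
    · intro k _ hk
      simp [β, Pi.single_eq_of_ne hk.symm]
    · simp
  -- Complex linearity fixes column l: the image of the real basis vector at l, divided by the entry
  -- of that vector.
  refine ⟨Matrix.of fun k l => (Q (β l) : b → ℂ) k * (rootCCW F l)⁻¹, fun u => ?_,
    fun M hM => ?_⟩
  · funext k
    conv_rhs => rw [hu u, map_sum, Submodule.coe_sum, Finset.sum_apply]
    refine Finset.sum_congr rfl fun l _ => ?_
    rw [map_smul, Submodule.coe_smul, Pi.smul_apply, Complex.real_smul]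
    change (Q (β l) : b → ℂ) k * (rootCCW F l)⁻¹ * (u : b → ℂ) l = _
    conv_lhs => rw [← realPart_mul_of_mem (dataR_mem u l)]
    have := rootCCW_ne_zero F l
    field_simp
  · ext k l
    have h := congrFun (hM (β l)) k
    simp only [β, Matrix.mulVec_single] at h
    rw [Matrix.of_apply, eq_mul_inv_iff_mul_eq₀ (rootCCW_ne_zero F l)]
    simpa using h

end Rps

/-! ### Glueing -/

section Glue

variable {F₁ F₂ : Finset Face}

theorem edges_union : edges (F₁ ∪ F₂) = edges F₁ ∪ edges F₂ := by
  ext e; simp only [mem_edges, Finset.mem_union]; tauto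

theorem mem_boundaryEdges_union_left (hd : Disjoint F₁ F₂) {e : GridEdge}
    (he : e ∈ boundaryEdges F₁ \ commonBoundary F₁ F₂) :
    e ∈ boundaryEdges (F₁ ∪ F₂) ∧ tauCCW (F₁ ∪ F₂) e = tauCCW F₁ e := by
  have c₁ : leftFace e ∈ F₁ → leftFace e ∉ F₂ := fun h => Finset.disjoint_left.mp hd h
  have c₂ : rightFace e ∈ F₁ → rightFace e ∉ F₂ := fun h => Finset.disjoint_left.mp hd h
  simp only [commonBoundary, Finset.mem_sdiff, Finset.mem_inter, mem_boundaryEdges, tauCCW,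
    Finset.mem_union] at he ⊢
  have : leftFace e ∈ F₁ ∪ F₂ ↔ leftFace e ∈ F₁ := by
    rw [Finset.mem_union]; tauto
  constructor
  · tauto
  · simp only [← Finset.mem_union, this]

theorem commonBoundary_comm : commonBoundary F₁ F₂ = commonBoundary F₂ F₁ :=
  Finset.inter_comm _ _

theorem mem_boundaryEdges_union_right (hd : Disjoint F₁ F₂) {e : GridEdge}
    (he : e ∈ boundaryEdges F₂ \ commonBoundary F₁ F₂) :
    e ∈ boundaryEdges (F₁ ∪ F₂) ∧ tauCCW (F₁ ∪ F₂) e = tauCCW F₂ e := by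
  rw [Finset.union_comm]
  exact mem_boundaryEdges_union_left hd.symm (commonBoundary_comm (F₁ := F₁) ▸ he)

theorem boundaryEdges_union_cases (hd : Disjoint F₁ F₂) {e : GridEdge}
    (he : e ∈ boundaryEdges (F₁ ∪ F₂)) :
    e ∈ boundaryEdges F₁ \ commonBoundary F₁ F₂ ∨
      e ∈ boundaryEdges F₂ \ commonBoundary F₁ F₂ := by
  have c₁ : leftFace e ∈ F₁ → leftFace e ∉ F₂ := fun h => Finset.disjoint_left.mp hd h
  have c₂ : rightFace e ∈ F₁ → rightFace e ∉ F₂ := fun h => Finset.disjoint_left.mp hd h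
  simp only [commonBoundary, Finset.mem_sdiff, Finset.mem_inter, mem_boundaryEdges,
    Finset.mem_union] at he ⊢
  tauto

theorem mem_commonBoundary_of_mem_edges (hd : Disjoint F₁ F₂) {e : GridEdge}
    (h₁ : e ∈ edges F₁) (h₂ : e ∈ edges F₂) : e ∈ commonBoundary F₁ F₂ := by
  have c₁ : leftFace e ∈ F₁ → leftFace e ∉ F₂ := fun h => Finset.disjoint_left.mp hd h
  have c₂ : rightFace e ∈ F₁ → rightFace e ∉ F₂ := fun h => Finset.disjoint_left.mp hd h
  simp only [commonBoundary, Finset.mem_inter, mem_boundaryEdges, mem_edges] at *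
  tauto

/-- Values on `F₁` and `F₂` that agree on the common boundary. -/
noncomputable def glue (F₁ : Finset Face) (h₁ h₂ : GridEdge → ℂ) (e : GridEdge) : ℂ :=
  if e ∈ edges F₁ then h₁ e else h₂ e

/-- The equations involve one face at a time, and each face lies in one of the two domains. -/
theorem sHolomorphic_glue (hd : Disjoint F₁ F₂) {h₁ h₂ : GridEdge → ℂ}
    (hh₁ : SHolomorphic F₁ h₁) (hh₂ : SHolomorphic F₂ h₂)
    (h : ∀ e ∈ commonBoundary F₁ F₂, h₁ e = h₂ e) :
    SHolomorphic (F₁ ∪ F₂) (glue F₁ h₁ h₂) := by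
  have k₁ : SHolomorphic F₁ (glue F₁ h₁ h₂) := hh₁.congr fun e he => by simp [glue, he]
  have k₂ : SHolomorphic F₂ (glue F₁ h₁ h₂) := hh₂.congr fun e he => by
    by_cases he₁ : e ∈ edges F₁
    · simp [glue, he₁, h e (mem_commonBoundary_of_mem_edges hd he₁ he)]
    · simp [glue, he₁]
  intro p hp
  rcases Finset.mem_union.mp hp with hp | hp
  · exact k₁ p hp
  · exact k₂ p hp

theorem commonBoundary_subset_left : commonBoundary F₁ F₂ ⊆ boundaryEdges F₁ :=
  Finset.inter_subset_left

theorem commonBoundary_subset_right : commonBoundary F₁ F₂ ⊆ boundaryEdges F₂ :=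
  Finset.inter_subset_right

/-- By proof irrelevance the identifications may use any proofs of the equalities, which makes the
composition convenient to rewrite. -/
theorem rpsComp_eq (hd : Disjoint F₁ F₂)
    (e₁ : dataI F₁ (commonBoundary F₁ F₂) = dataR F₂ (commonBoundary F₁ F₂))
    (e₂ : dataI F₂ (commonBoundary F₁ F₂) = dataR F₁ (commonBoundary F₁ F₂)) :
    rpsComp F₁ F₂ hd = (LinearEquiv.ofEq _ _ e₁).toLinearMap ∘ₗ rps F₁ (commonBoundary F₁ F₂) ∘ₗ
      (LinearEquiv.ofEq _ _ e₂).toLinearMap ∘ₗ rps F₂ (commonBoundary F₁ F₂) := rfl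

/-- The data of a function on the second domain and the composition of the two operators. -/
theorem rpsComp_coe (hd : Disjoint F₁ F₂) {s : dataR F₂ (commonBoundary F₁ F₂)}
    {r : dataI F₂ (commonBoundary F₁ F₂)} {r' : dataR F₁ (commonBoundary F₁ F₂)}
    {t : dataI F₁ (commonBoundary F₁ F₂)}
    (h₂ : HasSHolExtension F₂ (commonBoundary F₁ F₂) s r)
    (hr : (r : commonBoundary F₁ F₂ → ℂ) = r')
    (h₁ : HasSHolExtension F₁ (commonBoundary F₁ F₂) r' t) :
    (rpsComp F₁ F₂ hd s : commonBoundary F₁ F₂ → ℂ) = t := by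
  have c₁ := dataI_eq_dataR hd (b := commonBoundary F₁ F₂) commonBoundary_subset_left
    commonBoundary_subset_right
  have c₂ := dataI_eq_dataR hd.symm (b := commonBoundary F₁ F₂) commonBoundary_subset_right
    commonBoundary_subset_left
  have key := LinearMap.congr_fun (rpsComp_eq hd c₁ c₂) s
  rw [LinearMap.comp_apply, LinearMap.comp_apply, LinearMap.comp_apply, LinearEquiv.coe_coe,
    LinearEquiv.coe_coe, ← (hasSHolExtension_iff commonBoundary_subset_right s r).mp h₂] at key
  have h : LinearEquiv.ofEq _ _ c₂ r = r' :=
    Subtype.ext ((LinearEquiv.coe_ofEq_apply c₂ r).trans hr)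
  rw [h, ← (hasSHolExtension_iff commonBoundary_subset_left r' t).mp h₁] at key
  exact (congrArg Subtype.val key).trans (LinearEquiv.coe_ofEq_apply c₁ t)

/-- For a fixed point s, the extension of s + U₂s to `F₂` and that of U₂s + U₁U₂s = U₂s + s to `F₁`
agree on the common boundary. Glued, they satisfy the τ_cw condition on the whole boundary of the
union and vanish. Then s = -U₂s lies on two transversal lines. -/
theorem one_sub_rpsComp_injective (hd : Disjoint F₁ F₂) :
    Function.Injective
      (1 - rpsComp F₁ F₂ hd : Module.End ℝ (dataR F₂ (commonBoundary F₁ F₂))) := by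
  rw [← LinearMap.ker_eq_bot, LinearMap.ker_eq_bot']
  intro s hs
  have hs' : (rpsComp F₁ F₂ hd s : commonBoundary F₁ F₂ → ℂ) = s := by
    rw [LinearMap.sub_apply, Module.End.one_apply] at hs
    rw [← sub_eq_zero.mp hs]
  have hr₂ := hasSHolExtension_rps commonBoundary_subset_right s
  obtain ⟨r', hr'⟩ : ∃ r' : dataR F₁ (commonBoundary F₁ F₂),
      (rps F₂ (commonBoundary F₁ F₂) s : commonBoundary F₁ F₂ → ℂ) = r' :=
    ⟨⟨_, dataI_eq_dataR hd.symm commonBoundary_subset_right commonBoundary_subset_left ▸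
      (rps F₂ (commonBoundary F₁ F₂) s).2⟩, rfl⟩
  have hr₁ := hasSHolExtension_rps commonBoundary_subset_left r'
  have ht := rpsComp_coe hd hr₂ hr' hr₁
  rw [hs'] at ht
  obtain ⟨k₂, a₂, b₂, c₂⟩ := hr₂
  obtain ⟨k₁, a₁, b₁, c₁⟩ := hr₁
  have hk : ∀ e ∈ commonBoundary F₁ F₂, k₁ e = k₂ e := by
    intro e he
    have x₁ := b₁ ⟨e, he⟩
    have x₂ := b₂ ⟨e, he⟩
    simp only at x₁ x₂
    rw [x₁, x₂, ← ht, hr', add_comm]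
  have hzero := eq_zero_on_boundary (sHolomorphic_glue hd a₁ a₂ hk)
  have hg : ∀ e ∈ edges (F₁ ∪ F₂), glue F₁ k₁ k₂ e = 0 := by
    refine eq_zero_of_boundary_eq_zero (sHolomorphic_glue hd a₁ a₂ hk) (hzero fun e he => ?_)
    rcases boundaryEdges_union_cases hd he with he | he
    · have hm : e ∈ edges F₁ := boundaryEdges_subset _ (Finset.mem_sdiff.mp he).1
      rw [tauCW, (mem_boundaryEdges_union_left hd he).2, glue, if_pos hm]
      exact c₁ e he
    · have hm : e ∉ edges F₁ := fun hm => (Finset.mem_sdiff.mp he).2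
        (mem_commonBoundary_of_mem_edges hd hm
          (boundaryEdges_subset _ (Finset.mem_sdiff.mp he).1))
      rw [tauCW, (mem_boundaryEdges_union_right hd he).2, glue, if_neg hm]
      exact c₂ e he
  apply Subtype.ext
  funext e
  have hm : (e : GridEdge) ∈ edges F₁ := boundaryEdges_subset _ (commonBoundary_subset_left e.2)
  have h0 := hg e (by rw [edges_union]; exact Finset.mem_union_left _ hm)
  rw [glue, if_pos hm, hk e e.2, b₂] at h0
  have hI := dataI_mem (rps F₂ (commonBoundary F₁ F₂) s) e
  rw [eq_neg_of_add_eq_zero_right h0, Submodule.neg_mem_iff] at hI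
  exact eq_zero_of_mem_of_mem (dataR_mem s e) hI

theorem exists_inverse_one_sub_rpsComp (hd : Disjoint F₁ F₂) :
    ∃ Q : Module.End ℝ (dataR F₂ (commonBoundary F₁ F₂)),
      (1 - rpsComp F₁ F₂ hd) * Q = 1 ∧ Q * (1 - rpsComp F₁ F₂ hd) = 1 := by
  have h := one_sub_rpsComp_injective hd
  have hu : IsUnit (1 - rpsComp F₁ F₂ hd) :=
    (Module.End.isUnit_iff _).mpr ⟨h, LinearMap.injective_iff_surjective.mp h⟩
  obtain ⟨u, hu⟩ := hu
  exact ⟨(u⁻¹ : _ˣ), by rw [← hu, Units.mul_inv], by rw [← hu, Units.inv_mul]⟩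

end Glue

/-! ### Parities of configurations -/

theorem leftFace_rightFace_side (p : Face) (d : Dir) :
    (leftFace (side p d) = p ∧ rightFace (side p d) = step p d) ∨
      (leftFace (side p d) = step p d ∧ rightFace (side p d) = p) := by
  fin_cases d <;> simp [side, leftFace, rightFace, step]

theorem step_ne (p : Face) (d : Dir) : step p d ≠ p := by
  intro h
  rcases leftFace_rightFace_side p d with h' | h' <;>
    exact leftFace_ne_rightFace (side p d) (by rw [h'.1, h'.2, h])

theorem side_step (p : Face) (d : Dir) : side (step p d) (d + 2) = side p d := by
  fin_cases d <;> simp [side, step]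

theorem step_step (p : Face) (d : Dir) : step (step p d) (d + 2) = p := by
  fin_cases d <;> simp [step]

theorem side_eq_side_iff {p p' : Face} {d d' : Dir} :
    side p' d' = side p d ↔ (p' = p ∧ d' = d) ∨ (p' = step p d ∧ d' = d + 2) := by
  constructor
  · intro h
    rcases (exists_side_eq_iff p' (side p d)).mp ⟨d', h⟩ with h' | h' <;>
    rcases leftFace_rightFace_side p d with ⟨h₁, h₂⟩ | ⟨h₁, h₂⟩ <;>
    simp only [h₁, h₂] at h' <;> subst h' <;>
    first
      | exact Or.inl ⟨rfl, side_injective _ h⟩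
      | exact Or.inr ⟨rfl, side_injective _ (h.trans (side_step p d).symm)⟩
  · rintro (⟨rfl, rfl⟩ | ⟨rfl, rfl⟩)
    · rfl
    · exact side_step p d

theorem degree_eq_sum (S : Finset GridEdge) (p : Face) :
    (degree S p : ZMod 2) = ∑ d, if side p d ∈ S then 1 else 0 := by
  rw [degree, Finset.card_filter]
  push_cast
  rfl

theorem degree_mk (S : Finset GridEdge) (x y : ℤ) :
    (degree S (x, y) : ZMod 2) = (if .ver (x + 1) y ∈ S then 1 else 0) +
      (if .hor x (y + 1) ∈ S then 1 else 0) + (if .ver x y ∈ S then 1 else 0) +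
      if .hor x y ∈ S then 1 else 0 := by
  rw [degree_eq_sum, Fin.sum_univ_four]
  rfl

theorem degree_insert {S : Finset GridEdge} {p₀ : Face} {d₀ : Dir} (h : side p₀ d₀ ∉ S)
    (p : Face) : (degree (insert (side p₀ d₀) S) p : ZMod 2) =
      degree S p + (if p = p₀ then 1 else 0) + (if p = step p₀ d₀ then 1 else 0) := by
  have h₁ : ∀ d, (if side p d ∈ insert (side p₀ d₀) S then 1 else 0 : ZMod 2) =
      (if side p d ∈ S then 1 else 0) + if side p d = side p₀ d₀ then 1 else 0 := by
    intro d
    by_cases hd : side p d = side p₀ d₀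
    · simp [hd, h]
    · simp [hd]
  rw [degree_eq_sum, degree_eq_sum, Finset.sum_congr rfl fun d _ => h₁ d, Finset.sum_add_distrib,
    add_assoc]
  congr 1
  simp only [side_eq_side_iff]
  by_cases hp : p = p₀
  · subst hp
    simp [(step_ne p d₀).symm]
  · by_cases hp' : p = step p₀ d₀
    · subst hp'
      simp [step_ne p₀ d₀]
    · simp [hp, hp']

/-- Configurations of dual edges with the sinks `g` and `q`; the edge `z` at which the path ends
is not used. -/
structure IsConfig (g : Face) (z : GridEdge) (q : Face) (S : Finset GridEdge) : Prop where
  notMem : z ∉ S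
  parity : ∀ p, (degree S p : ZMod 2) + (if p = q then 1 else 0) + (if p = g then 1 else 0) = 0

/-! ### Ray parities and the strip identity -/

/-- The horizontal edges to the right of the point `v`. -/
def OnRay (v : ℤ × ℤ) : GridEdge → Prop
  | .hor x y => v.1 ≤ x ∧ y = v.2
  | .ver _ _ => False

instance (v : ℤ × ℤ) : DecidablePred (OnRay v) := fun e => by
  cases e <;> unfold OnRay <;> infer_instance

theorem onRay_hor (v : ℤ × ℤ) (x y : ℤ) : OnRay v (.hor x y) ↔ v.1 ≤ x ∧ y = v.2 := Iff.rfl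

theorem not_onRay_ver (v : ℤ × ℤ) (x y : ℤ) : ¬ OnRay v (.ver x y) := id

/-- The horizontal edges to the left of the point `v`. -/
def OnLeftRay (v : ℤ × ℤ) : GridEdge → Prop
  | .hor x y => x < v.1 ∧ y = v.2
  | .ver _ _ => False

instance (v : ℤ × ℤ) : DecidablePred (OnLeftRay v) := fun e => by
  cases e <;> unfold OnLeftRay <;> infer_instance

theorem onLeftRay_hor (v : ℤ × ℤ) (x y : ℤ) : OnLeftRay v (.hor x y) ↔ x < v.1 ∧ y = v.2 :=
  Iff.rfl

theorem not_onLeftRay_ver (v : ℤ × ℤ) (x y : ℤ) : ¬ OnLeftRay v (.ver x y) := id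

/-- The parity of the number of edges on a ray. -/
def rayParity (S : Finset GridEdge) (v : ℤ × ℤ) : ZMod 2 :=
  ∑ e ∈ S, if OnRay v e then 1 else 0

theorem rayParity_insert {S : Finset GridEdge} {e : GridEdge} (h : e ∉ S) (v : ℤ × ℤ) :
    rayParity (insert e S) v = rayParity S v + if OnRay v e then 1 else 0 := by
  rw [rayParity, Finset.sum_insert h, add_comm]; rfl

theorem rayParity_succ (S : Finset GridEdge) (x y : ℤ) :
    rayParity S (x, y) = rayParity S (x + 1, y) + if GridEdge.hor x y ∈ S then 1 else 0 := by
  have h : ∀ e, (if OnRay (x, y) e then 1 else 0 : ZMod 2) =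
      (if OnRay (x + 1, y) e then 1 else 0) + if GridEdge.hor x y = e then 1 else 0 := by
    rintro (⟨x', y'⟩ | ⟨x', y'⟩)
    · simp only [onRay_hor, GridEdge.hor.injEq]
      split_ifs <;> first | omega | rfl
    · simp [OnRay]
  rw [rayParity, Finset.sum_congr rfl fun e _ => h e, Finset.sum_add_distrib, Finset.sum_ite_eq]
  rfl

/-- The edges that leave a half-infinite horizontal strip. -/
theorem IsConfig.strip {g q : Face} {z : GridEdge} {S : Finset GridEdge} (h : IsConfig g z q S)
    (x y : ℤ) :
    rayParity S (x, y + 1) + rayParity S (x, y) + (if GridEdge.ver x y ∈ S then 1 else 0) =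
      (if x ≤ q.1 ∧ q.2 = y then 1 else 0) + (if x ≤ g.1 ∧ g.2 = y then 1 else 0) := by
  obtain ⟨X, hX⟩ : ∃ X : ℤ, ∀ e ∈ S, ∀ x y : ℤ, (e = .hor x y ∨ e = .ver x y) → x < X := by
    obtain ⟨X, hX⟩ := (S.image fun e => (rightFace e).1).bddAbove
    refine ⟨X + 1, ?_⟩
    rintro e he x y (rfl | rfl)
    · have := hX (Finset.mem_coe.mpr (Finset.mem_image_of_mem _ he))
      simp only [rightFace] at this; omega
    · have := hX (Finset.mem_coe.mpr (Finset.mem_image_of_mem _ he))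
      simp only [rightFace] at this; omega
  have hfar : ∀ x y, X ≤ x → rayParity S (x, y) = 0 := by
    intro x y hx
    refine Finset.sum_eq_zero fun e he => if_neg ?_
    rcases e with ⟨x', y'⟩ | ⟨x', y'⟩
    · have := hX _ he x' y' (Or.inl rfl)
      simp only [OnRay]; omega
    · simp [OnRay]
  -- Induct leftwards from beyond all edges and sinks. Each step adds the parity relation of the
  -- face (x, y), in which the vertical side shared with the old strip cancels.
  have key : ∀ n : ℕ, ∀ x, max X (max (q.1 + 1) (g.1 + 1)) - n = x →
      rayParity S (x, y + 1) + rayParity S (x, y) + (if GridEdge.ver x y ∈ S then 1 else 0) =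
      (if x ≤ q.1 ∧ q.2 = y then 1 else 0) + (if x ≤ g.1 ∧ g.2 = y then 1 else 0) := by
    intro n
    induction n with
    | zero =>
      intro x hx
      have hver : GridEdge.ver x y ∉ S := fun he => by
        have := hX _ he x y (Or.inr rfl); omega
      rw [hfar _ _ (by omega), hfar _ _ (by omega), if_neg hver, if_neg (by omega),
        if_neg (by omega)]
      rfl
    | succ n ih =>
      intro x hx
      have h₁ := ih (x + 1) (by push_cast at hx; omega)
      have h₂ := h.parity (x, y)
      rw [degree_mk] at h₂
      rw [rayParity_succ S x (y + 1), rayParity_succ S x y]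
      have hq : (if x ≤ q.1 ∧ q.2 = y then 1 else 0 : ZMod 2) =
          (if x + 1 ≤ q.1 ∧ q.2 = y then 1 else 0) + if ((x, y) : Face) = q then 1 else 0 := by
        simp only [Prod.ext_iff]
        split_ifs <;> first | omega | rfl
      have hg : (if x ≤ g.1 ∧ g.2 = y then 1 else 0 : ZMod 2) =
          (if x + 1 ≤ g.1 ∧ g.2 = y then 1 else 0) + if ((x, y) : Face) = g then 1 else 0 := by
        simp only [Prod.ext_iff]
        split_ifs <;> first | omega | rfl
      rw [hq, hg]
      have h0 : (2 : ZMod 2) = 0 := rfl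
      linear_combination h₁ + h₂ - (if ((x, y) : Face) = q then 1 else 0) * h0 -
        (if ((x, y) : Face) = g then 1 else 0) * h0 -
        (if GridEdge.ver (x + 1) y ∈ S then 1 else 0) * h0
  by_cases hx : x ≤ max X (max (q.1 + 1) (g.1 + 1))
  · exact key (max X (max (q.1 + 1) (g.1 + 1)) - x).toNat x (by omega)
  · have hver : GridEdge.ver x y ∉ S := fun he => by
      have := hX _ he x y (Or.inr rfl); omega
    rw [hfar _ _ (by omega), hfar _ _ (by omega), if_neg hver, if_neg (by omega),
      if_neg (by omega)]
    rfl

/-! ### The sign of a configuration and its change at a corner -/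

/-- The end point of an edge from which a ray starts. -/
def rayBase : GridEdge → ℤ × ℤ
  | .hor x y => (x + 1, y)
  | .ver x y => (x, y + 1)

/-- The exponent of the sign of a configuration. -/
def spin (g : Face) (z : GridEdge) (q : Face) (S : Finset GridEdge) : ZMod 2 :=
  rayParity S (rayBase z) + rayParity S g + (if g.2 ≤ q.2 then 1 else 0) +
    if OnLeftRay g z ∧ g.2 ≤ q.2 then 1 else 0

/-- Adjoin an edge if the flag is set. -/
def adjoin (B : Finset GridEdge) (β : Bool) (e : GridEdge) : Finset GridEdge :=
  if β then insert e B else B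

/-- The face on the near or far side of the side `d` of `p`. -/
def farFace (p : Face) (d : Dir) (β : Bool) : Face := if β then step p d else p

/-- The direction of a path that ends at the side `d` of `p`, coming from `p` or from the
other face. -/
def arrivalDir (d : Dir) (β : Bool) : Dir := if β then d + 2 else d

/-- Here `B` is what the configuration has off the two sides, and β, β' record whether the far
halves of sides d, d' are used. Moving the end from the middle of one side to the middle of the
other through `p` keeps both flags: a far arrival at d becomes a full edge there, and a full edge at
d' becomes a far arrival. -/
theorem IsConfig.swap {g p : Face} {d d' : Dir} (hd : d ≠ d') {B : Finset GridEdge}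
    (h₁ : side p d ∉ B) (h₂ : side p d' ∉ B) {β β' : Bool}
    (h : IsConfig g (side p d) (farFace p d β) (adjoin B β' (side p d'))) :
    IsConfig g (side p d') (farFace p d' β') (adjoin B β (side p d)) := by
  have hne : side p d' ≠ side p d := fun h => hd (side_injective p h.symm)
  refine ⟨?_, fun p' => ?_⟩
  · cases β <;> simp [adjoin, h₂, hne]
  · have := h.parity p'
    have h0 : (2 : ZMod 2) = 0 := rfl
    cases β <;> cases β' <;>
      simp only [adjoin, farFace, if_true, Bool.false_eq_true, if_false, degree_insert h₁,
        degree_insert h₂] at this ⊢ <;>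
      first
        | exact this
        | linear_combination this + (if p' = p then 1 else 0) * h0
        | linear_combination this - (if p' = p then 1 else 0) * h0
        | linear_combination this

/-- The directions that get a sign at a corner. -/
def cornerFlip : Fin 4 → Dir → ZMod 2 :=
  ![![0, 0, 0, 0], ![0, 0, 0, 1], ![0, 0, 1, 0], ![1, 0, 0, 1]]

/-- The part of the sign that comes from the ray at the sink `g`. -/
def sinkSpin (g : Face) (z : GridEdge) (q : Face) (S : Finset GridEdge) : ZMod 2 :=
  rayParity S g + (if g.2 ≤ q.2 then 1 else 0) + if OnLeftRay g z ∧ g.2 ≤ q.2 then 1 else 0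

theorem spin_eq (g : Face) (z : GridEdge) (q : Face) (S : Finset GridEdge) :
    spin g z q S = rayParity S (rayBase z) + sinkSpin g z q S := by
  rw [spin, sinkSpin]; ring

theorem sinkSpin_ver (g : Face) (x y : ℤ) (q : Face) (S : Finset GridEdge) :
    sinkSpin g (.ver x y) q S = rayParity S g + if g.2 ≤ q.2 then 1 else 0 := by
  simp [sinkSpin, not_onLeftRay_ver]

theorem rayParity_adjoin_ver {B : Finset GridEdge} {x y : ℤ} (h : .ver x y ∉ B) (β : Bool)
    (v : ℤ × ℤ) : rayParity (adjoin B β (.ver x y)) v = rayParity B v := by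
  cases β <;> simp [adjoin, rayParity_insert h, not_onRay_ver]

theorem rayParity_adjoin {B : Finset GridEdge} {e : GridEdge} (h : e ∉ B) (β : Bool)
    (v : ℤ × ℤ) : rayParity (adjoin B β e) v =
      rayParity B v + if β ∧ OnRay v e then 1 else 0 := by
  cases β <;> simp [adjoin, rayParity_insert h]

/-- If the end leaves the far side of the line through the corner of `g`, the change of the height
term is made up by the edge itself, which lies on the right or on the left ray. -/
theorem sinkSpin_north {B : Finset GridEdge} (g : Face) {x y x' : ℤ} {q : Face} {β β' : Bool}
    (h₁ : .hor x (y + 1) ∉ B) (h₂ : .ver x' y ∉ B) (hq : q.2 = y) :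
    sinkSpin g (.hor x (y + 1)) (farFace (x, y) 1 β) (adjoin B β' (.ver x' y)) =
      sinkSpin g (.ver x' y) q (adjoin B β (.hor x (y + 1))) := by
  rw [sinkSpin_ver, sinkSpin, rayParity_adjoin_ver h₂, rayParity_adjoin h₁]
  simp only [onRay_hor, onLeftRay_hor, hq]
  cases β <;> simp only [farFace, step, if_true, Bool.false_eq_true, if_false, false_and,
    true_and] <;> split_ifs <;> first | omega | (generalize rayParity B g = t; revert t; decide)

/-- As on the north side, except that the left ray now leaves a term; it cancels the contribution of
`g` in the strip identity. -/
theorem sinkSpin_south {B : Finset GridEdge} {g : Face} {x y x' : ℤ} {q : Face} {β β' : Bool}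
    (hp : (x, y) ≠ g)
    (h₁ : .hor x y ∉ B) (h₂ : .ver x' y ∉ B) (hq : q.2 = y) :
    sinkSpin g (.hor x y) (farFace (x, y) 3 β) (adjoin B β' (.ver x' y)) =
      sinkSpin g (.ver x' y) q (adjoin B β (.hor x y)) +
        if x + 1 ≤ g.1 ∧ g.2 = y then 1 else 0 := by
  have hp' : ¬ (x = g.1 ∧ y = g.2) := fun h => hp (Prod.ext h.1 h.2)
  rw [sinkSpin_ver, sinkSpin, rayParity_adjoin_ver h₂, rayParity_adjoin h₁]
  simp only [onRay_hor, onLeftRay_hor, hq]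
  cases β <;> simp only [farFace, step, if_true, Bool.false_eq_true, if_false, false_and,
    true_and] <;> split_ifs <;> first | omega | (generalize rayParity B g = t; revert t; decide)

/-- Both edges have their ray based at the common corner, so nothing changes. -/
theorem spin_northEast {B : Finset GridEdge} (g : Face) {x y : ℤ} {β β' : Bool}
    (h₁ : .hor x (y + 1) ∉ B) (h₂ : .ver (x + 1) y ∉ B) :
    spin g (.hor x (y + 1)) (farFace (x, y) 1 β) (adjoin B β' (.ver (x + 1) y)) =
      spin g (.ver (x + 1) y) (farFace (x, y) 0 β') (adjoin B β (.hor x (y + 1))) := by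
  rw [spin_eq, spin_eq, sinkSpin_north g h₁ h₂ (q := farFace (x, y) 0 β') (by cases β' <;> rfl)]
  simp [rayBase, rayParity_adjoin_ver h₂, rayParity_adjoin h₁, onRay_hor]

/-- The two rays differ by the north side itself, which is in the configuration exactly when β is
set. -/
theorem spin_northWest {B : Finset GridEdge} (g : Face) {x y : ℤ} {β β' : Bool}
    (h₁ : .hor x (y + 1) ∉ B) (h₂ : .ver x y ∉ B) :
    spin g (.hor x (y + 1)) (farFace (x, y) 1 β) (adjoin B β' (.ver x y)) =
      spin g (.ver x y) (farFace (x, y) 2 β') (adjoin B β (.hor x (y + 1))) +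
        if β then 1 else 0 := by
  have h := rayParity_succ B x (y + 1)
  rw [if_neg h₁] at h
  rw [spin_eq, spin_eq, sinkSpin_north g h₁ h₂ (q := farFace (x, y) 2 β') (by cases β' <;> rfl)]
  simp only [rayBase, rayParity_adjoin_ver h₂, rayParity_adjoin h₁, onRay_hor, h]
  generalize sinkSpin _ _ _ _ = s, rayParity _ _ = t
  revert s t
  cases β <;> simp <;> decide

/-- The two rays bound a half-infinite strip to the right of `p`, so `IsConfig.strip` compares them;
the end face lies outside of this strip. -/
theorem spin_southEast {B : Finset GridEdge} {g : Face} {x y : ℤ} {β β' : Bool}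
    (hp : (x, y) ≠ g) (h₁ : .hor x y ∉ B) (h₂ : .ver (x + 1) y ∉ B)
    (h : IsConfig g (.hor x y) (farFace (x, y) 3 β) (adjoin B β' (.ver (x + 1) y))) :
    spin g (.hor x y) (farFace (x, y) 3 β) (adjoin B β' (.ver (x + 1) y)) =
      spin g (.ver (x + 1) y) (farFace (x, y) 0 β') (adjoin B β (.hor x y)) +
        if β' then 1 else 0 := by
  have hs := h.strip (x + 1) y
  have hq : (farFace (x, y) 3 β).1 = x := by cases β <;> rfl
  have hm : .ver (x + 1) y ∈ adjoin B β' (.ver (x + 1) y) ↔ β' = true := by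
    cases β' <;> simp [adjoin, h₂]
  rw [spin_eq, spin_eq, sinkSpin_south hp h₁ h₂ (q := farFace (x, y) 0 β') (by cases β' <;> rfl)]
  simp only [rayBase, rayParity_adjoin_ver h₂, rayParity_adjoin h₁, onRay_hor, hq, hm] at hs ⊢
  simp only [Int.not_le.mpr (lt_add_one x), false_and, and_false, if_false, add_zero,
    zero_add] at hs ⊢
  rw [← hs]
  generalize sinkSpin _ _ _ _ = s, rayParity B (x + 1, y + 1) = t, rayParity _ _ = u
  revert s t u
  cases β' <;> simp <;> decide

/-- The strip now starts with `p` itself, so it contains the end face unless the path arrives from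
below. -/
theorem spin_southWest {B : Finset GridEdge} {g : Face} {x y : ℤ} {β β' : Bool}
    (hp : (x, y) ≠ g) (h₁ : .hor x y ∉ B) (h₂ : .ver x y ∉ B)
    (h : IsConfig g (.hor x y) (farFace (x, y) 3 β) (adjoin B β' (.ver x y))) :
    spin g (.hor x y) (farFace (x, y) 3 β) (adjoin B β' (.ver x y)) =
      spin g (.ver x y) (farFace (x, y) 2 β') (adjoin B β (.hor x y)) +
        (if β' then 1 else 0) + if β then 0 else 1 := by
  have hs := h.strip x y
  have hr := rayParity_succ B x y
  rw [if_neg h₁, add_zero] at hr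
  have hp' : ¬ (x = g.1 ∧ y = g.2) := fun h => hp (Prod.ext h.1 h.2)
  have hg : (x + 1 ≤ g.1 ∧ g.2 = y) ↔ (x ≤ g.1 ∧ g.2 = y) := by omega
  have hq : (x ≤ (farFace (x, y) 3 β).1 ∧ (farFace (x, y) 3 β).2 = y) ↔ ¬ β = true := by
    cases β <;> simp [farFace, step]
  have hm : .ver x y ∈ adjoin B β' (.ver x y) ↔ β' = true := by
    cases β' <;> simp [adjoin, h₂]
  rw [spin_eq, spin_eq, sinkSpin_south hp h₁ h₂ (q := farFace (x, y) 2 β') (by cases β' <;> rfl)]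
  simp only [rayBase, rayParity_adjoin_ver h₂, rayParity_adjoin h₁, onRay_hor, hm, hq, hg,
    hr] at hs ⊢
  generalize sinkSpin _ _ _ _ = s, (if x ≤ g.1 ∧ g.2 = y then 1 else 0 : ZMod 2) = v at *
  obtain rfl := eq_sub_of_add_eq' hs.symm
  generalize rayParity _ _ = t, rayParity _ _ = u
  revert s t u
  cases β <;> cases β' <;> simp <;> decide

/-- The discrepancy in each of the four cases depends only on β and β', and `cornerFlip` absorbs it
as a function of the arrival directions. -/
theorem spin_corner {g p : Face} (hp : p ≠ g) (k : Fin 4) {B : Finset GridEdge} {β β' : Bool}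
    (h₁ : side p (corner k).1 ∉ B) (h₂ : side p (corner k).2.1 ∉ B)
    (h : IsConfig g (side p (corner k).1) (farFace p (corner k).1 β)
      (adjoin B β' (side p (corner k).2.1))) :
    spin g (side p (corner k).1) (farFace p (corner k).1 β)
        (adjoin B β' (side p (corner k).2.1)) + cornerFlip k (arrivalDir (corner k).1 β) =
      spin g (side p (corner k).2.1) (farFace p (corner k).2.1 β')
        (adjoin B β (side p (corner k).1)) + cornerFlip k (arrivalDir (corner k).2.1 β') := by
  obtain ⟨x, y⟩ := p
  fin_cases k
  · have aux : ∀ s : ZMod 2, s + cornerFlip 0 (arrivalDir 1 β) =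
        s + cornerFlip 0 (arrivalDir 0 β') := by
      cases β <;> cases β' <;> decide
    exact (congrArg (· + _) (spin_northEast g h₁ h₂)).trans (aux _)
  · have aux : ∀ s : ZMod 2, s + (if β then 1 else 0) + cornerFlip 1 (arrivalDir 1 β) =
        s + cornerFlip 1 (arrivalDir 2 β') := by
      cases β <;> cases β' <;> decide
    exact (congrArg (· + _) (spin_northWest g h₁ h₂)).trans (aux _)
  · have aux : ∀ s : ZMod 2, s + (if β' then 1 else 0) + cornerFlip 2 (arrivalDir 3 β) =
        s + cornerFlip 2 (arrivalDir 0 β') := by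
      cases β <;> cases β' <;> decide
    exact (congrArg (· + _) (spin_southEast hp h₁ h₂ h)).trans (aux _)
  · have aux : ∀ s : ZMod 2, s + (if β' then 1 else 0) + (if β then 0 else 1) +
        cornerFlip 3 (arrivalDir 3 β) = s + cornerFlip 3 (arrivalDir 2 β') := by
      cases β <;> cases β' <;> decide
    exact (congrArg (· + _) (spin_southWest hp h₁ h₂ h)).trans (aux _)

/-! ### The phase of a configuration -/

/-- The sign of an exponent. -/
def sgn (s : ZMod 2) : ℝ := if s = 0 then 1 else -1

theorem sgn_add (s t : ZMod 2) : sgn (s + t) = sgn s * sgn t := by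
  have h : ∀ s : ZMod 2, s = 0 ∨ s = 1 := by decide
  have h₁ : (1 : ZMod 2) + 1 = 0 := rfl
  rcases h s with rfl | rfl <;> rcases h t with rfl | rfl <;> simp [sgn, h₁]

theorem sgn_mul_self (s : ZMod 2) : (sgn s : ℂ) * sgn s = 1 := by
  rw [sgn]; split_ifs <;> norm_num

theorem lam_ne_zero : lam ≠ 0 := Complex.exp_ne_zero _

theorem lam_zpow (n : ℤ) : lam ^ n = Complex.exp (n * (Complex.I * Real.pi / 4)) := by
  rw [lam, ← Complex.exp_int_mul]

theorem lam_zpow_four : lam ^ (4 : ℤ) = -1 := by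
  rw [lam_zpow, ← Complex.exp_pi_mul_I]
  congr 1
  push_cast
  ring

/-- The exponent of the unit vector that belongs to a direction of arrival. -/
def dirExponent : Dir → ℤ := ![1, 0, -1, 2]

/-- The unit vector that belongs to a direction of arrival. -/
noncomputable def dirUnit (d : Dir) : ℂ := lam ^ dirExponent d

theorem dirUnit_ne_zero (d : Dir) : dirUnit d ≠ 0 := zpow_ne_zero _ lam_ne_zero

/-- The direction of a path that arrives at the edge `z` from the face `q`. -/
def arrival (z : GridEdge) (q : Face) : Dir :=
  match z with
  | .hor x y => if q = (x, y) then 3 else 1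
  | .ver x y => if q = (x, y) then 2 else 0

theorem arrival_side (p : Face) (d : Dir) (β : Bool) :
    arrival (side p d) (farFace p d β) = arrivalDir d β := by
  obtain ⟨x, y⟩ := p
  fin_cases d <;> cases β <;> simp [arrival, side, farFace, step, arrivalDir]

theorem arrival_near (p : Face) (d : Dir) : arrival (side p d) p = d :=
  arrival_side p d false

theorem arrival_far (p : Face) (d : Dir) : arrival (side p d) (step p d) = d + 2 :=
  arrival_side p d true

/-- The phase of a configuration. -/
noncomputable def phase (g : Face) (z : GridEdge) (q : Face) (S : Finset GridEdge) : ℂ :=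
  sgn (spin g z q S) * dirUnit (arrival z q)

/-- Angles of directions, in quarter turns, cut opposite to a corner. -/
def cornerLift : Fin 4 → Dir → ℤ :=
  ![![0, 1, 2, -1], ![0, 1, 2, 3], ![0, 1, -2, -1], ![4, 1, 2, 3]]

/-- Since λ⁴ = -1, a sign is a full turn in the half-angle. `cornerFlip` marks the directions whose
angle in `dirExponent` must change by a full turn to fit the branch of this corner. -/
theorem sgn_cornerFlip_mul (k : Fin 4) (d : Dir) :
    (sgn (cornerFlip k d) : ℂ) * dirUnit d = lam ^ (1 - cornerLift k d) := by
  have h₁ : ∀ k d, (cornerFlip k d = 0 ∧ dirExponent d = 1 - cornerLift k d) ∨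
      (cornerFlip k d = 1 ∧
        (dirExponent d = 1 - cornerLift k d + 4 ∨ dirExponent d + 4 = 1 - cornerLift k d)) := by
    decide
  rcases h₁ k d with ⟨h, h'⟩ | ⟨h, h' | h'⟩
  · simp [h, sgn, dirUnit, h']
  · rw [dirUnit, h', zpow_add₀ lam_ne_zero, lam_zpow_four]
    simp [h, sgn]
  · rw [dirUnit, ← h', zpow_add₀ lam_ne_zero, lam_zpow_four]
    simp [h, sgn]

/-- Up to a common factor, `phase` is exp(-iθ/2) for the arrival angle θ, in a branch that is
continuous for moves around this corner. -/
theorem phase_corner {g p : Face} (hp : p ≠ g) (k : Fin 4) {B : Finset GridEdge} {β β' : Bool}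
    (h₁ : side p (corner k).1 ∉ B) (h₂ : side p (corner k).2.1 ∉ B)
    (h : IsConfig g (side p (corner k).1) (farFace p (corner k).1 β)
      (adjoin B β' (side p (corner k).2.1))) :
    phase g (side p (corner k).1) (farFace p (corner k).1 β)
        (adjoin B β' (side p (corner k).2.1)) *
          lam ^ cornerLift k (arrivalDir (corner k).1 β) =
      phase g (side p (corner k).2.1) (farFace p (corner k).2.1 β')
        (adjoin B β (side p (corner k).1)) *
          lam ^ cornerLift k (arrivalDir (corner k).2.1 β') := by
  have key := congrArg sgn (spin_corner hp k h₁ h₂ h)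
  rw [sgn_add, sgn_add] at key
  have key' := congrArg (fun r : ℝ => (r : ℂ)) key
  simp only [Complex.ofReal_mul] at key'
  have a₁ := sgn_cornerFlip_mul k (arrivalDir (corner k).1 β)
  have a₂ := sgn_cornerFlip_mul k (arrivalDir (corner k).2.1 β')
  rw [zpow_sub₀ lam_ne_zero, zpow_one, eq_div_iff (zpow_ne_zero _ lam_ne_zero)] at a₁ a₂
  have n₁ := sgn_mul_self (cornerFlip k (arrivalDir (corner k).1 β))
  have n₂ := sgn_mul_self (cornerFlip k (arrivalDir (corner k).2.1 β'))
  rw [phase, phase, arrival_side, arrival_side]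
  generalize (sgn (spin _ _ _ _) : ℂ) = s at *
  generalize (sgn (spin _ _ _ _) : ℂ) = t at *
  generalize (sgn (cornerFlip k (arrivalDir (corner k).1 β)) : ℂ) = f,
    (sgn (cornerFlip k (arrivalDir (corner k).2.1 β')) : ℂ) = f',
    dirUnit (arrivalDir (corner k).1 β) = u, dirUnit (arrivalDir (corner k).2.1 β') = u',
    lam ^ cornerLift k (arrivalDir (corner k).1 β) = l,
    lam ^ cornerLift k (arrivalDir (corner k).2.1 β') = l' at *
  linear_combination lam * key' + s * f * a₁ - t * f' * a₂ - s * (u * l) * n₁ + t * (u' * l') * n₂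

/-- The corner between two adjacent sides (an arbitrary one in the other cases). -/
def cornerIndex : Dir → Dir → Fin 4 :=
  ![![0, 0, 0, 2], ![0, 0, 1, 0], ![0, 1, 0, 3], ![2, 0, 3, 0]]

theorem corner_cornerIndex {d d' : Dir} (h : d' = d + 1 ∨ d = d' + 1) :
    ((corner (cornerIndex d d')).1 = d ∧ (corner (cornerIndex d d')).2.1 = d') ∨
      ((corner (cornerIndex d d')).1 = d' ∧ (corner (cornerIndex d d')).2.1 = d) := by
  rcases h with rfl | rfl
  · fin_cases d <;> simp [cornerIndex, corner]
  · fin_cases d' <;> simp [cornerIndex, corner]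

theorem ne_of_adjacent : ∀ d d' : Dir, d' = d + 1 ∨ d = d' + 1 → d ≠ d' := by decide

theorem adjacent_of_ne : ∀ d m : Dir, m ≠ d → m ≠ d + 2 → m = d + 1 ∨ d = m + 1 := by decide

theorem adjacent_opposite : ∀ d m : Dir, m ≠ d → m ≠ d + 2 → m = d + 2 + 1 ∨ d + 2 = m + 1 := by
  decide

/-- The branch cut lies opposite to the corner, so a turn from d to m around that corner changes the
lifted angle by exactly that turn. -/
theorem cornerLift_turn : ∀ d m : Dir, m ≠ d → m ≠ d + 2 →
    cornerLift (cornerIndex (d + 2) m) (arrivalDir m false) =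
      cornerLift (cornerIndex (d + 2) m) (arrivalDir (d + 2) true) + quarterTurn d m := by
  decide

theorem cornerLift_return : ∀ d m : Dir, m ≠ d → m ≠ d + 2 →
    cornerLift (cornerIndex m d) (arrivalDir d false) + quarterTurn d m =
      cornerLift (cornerIndex m d) (arrivalDir m false) := by
  decide

/-- The corner relation without the order of sides imposed by `corner`; the reverse order uses
`IsConfig.swap`. -/
theorem phase_adjacent {g p : Face} (hp : p ≠ g) {d d' : Dir} (hd : d' = d + 1 ∨ d = d' + 1)
    {B : Finset GridEdge} {β β' : Bool} (h₁ : side p d ∉ B) (h₂ : side p d' ∉ B)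
    (h : IsConfig g (side p d) (farFace p d β) (adjoin B β' (side p d'))) :
    phase g (side p d) (farFace p d β) (adjoin B β' (side p d')) *
          lam ^ cornerLift (cornerIndex d d') (arrivalDir d β) =
      phase g (side p d') (farFace p d' β') (adjoin B β (side p d)) *
          lam ^ cornerLift (cornerIndex d d') (arrivalDir d' β') := by
  have hne : d ≠ d' := ne_of_adjacent d d' hd
  have key := fun β β' : Bool => @phase_corner g p hp (cornerIndex d d') B β β'
  rcases corner_cornerIndex hd with ⟨e₁, e₂⟩ | ⟨e₁, e₂⟩
  · rw [e₁, e₂] at key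
    exact key β β' h₁ h₂ h
  · rw [e₁, e₂] at key
    exact (key β' β h₂ h₁ (h.swap hne h₁ h₂)).symm

/-! ### The phase along a path -/

/-- The move of the end of a path through a face. -/
theorem phase_step {g p : Face} (hp : p ≠ g) {d d' : Dir} {T : Finset GridEdge}
    (h : IsConfig g (side p d') p T) (hT : side p (d + 2) ∈ T) (hd : d' ≠ d + 2)
    (hstraight : d' = d → ∃ m, m ≠ d ∧ m ≠ d + 2 ∧ side p m ∉ T) :
    IsConfig g (side p (d + 2)) (step p (d + 2)) (T.erase (side p (d + 2))) ∧
      phase g (side p d') p T =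
        phase g (side p (d + 2)) (step p (d + 2)) (T.erase (side p (d + 2))) *
          lam ^ (-quarterTurn d d') := by
  have hT' : adjoin (T.erase (side p (d + 2))) true (side p (d + 2)) = T := by
    simp [adjoin, Finset.insert_erase hT]
  have hc : IsConfig g (side p (d + 2)) (step p (d + 2)) (T.erase (side p (d + 2))) := by
    refine IsConfig.swap (β := false) (β' := true) hd
      (fun hm => h.notMem (Finset.mem_of_mem_erase hm)) (Finset.notMem_erase _ _) ?_
    rw [hT']
    exact h
  refine ⟨hc, ?_⟩
  -- a turn
  have turn : ∀ m, m ≠ d → m ≠ d + 2 → side p m ∉ T →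
      IsConfig g (side p m) p T ∧ phase g (side p m) p T =
        phase g (side p (d + 2)) (step p (d + 2)) (T.erase (side p (d + 2))) *
          lam ^ (-quarterTurn d m) := by
    intro m hm hm' hmT
    have a₁ : side p m ∉ T.erase (side p (d + 2)) := fun h => hmT (Finset.mem_of_mem_erase h)
    have a₂ : side p (d + 2) ∉ T.erase (side p (d + 2)) := Finset.notMem_erase _ _
    have hcm : IsConfig g (side p m) p T := by
      have := IsConfig.swap (β := true) (β' := false) hm'.symm a₂ a₁ hc
      rwa [hT'] at this
    refine ⟨hcm, ?_⟩
    have key := phase_adjacent (β := true) (β' := false) hp (d := d + 2) (d' := m)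
      (adjacent_opposite d m hm hm') a₂ a₁ hc
    rw [hT'] at key
    rw [cornerLift_turn d m hm hm', zpow_add₀ lam_ne_zero, mul_comm (lam ^ _) (lam ^ quarterTurn d m), ← mul_assoc] at key
    have key := mul_right_cancel₀ (zpow_ne_zero _ lam_ne_zero) key
    rw [zpow_neg, eq_mul_inv_iff_mul_eq₀ (zpow_ne_zero _ lam_ne_zero)]
    exact key.symm
  -- Opposite sides have no common corner. A straight move is made in two corner moves through an
  -- unoccupied lateral side `m`, whose quarter turns cancel.
  by_cases hdd : d' = d
  · obtain ⟨m, hm, hm', hmT⟩ := hstraight hdd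
    subst hdd
    obtain ⟨hcm, hphase⟩ := turn m hm hm' hmT
    have key := phase_adjacent (β := false) (β' := false) hp (d := m) (d' := d') (B := T)
      (adjacent_of_ne d' m hm hm').symm hmT h.notMem hcm
    rw [← cornerLift_return d' m hm hm', zpow_add₀ lam_ne_zero,
      mul_comm (lam ^ cornerLift _ _) (lam ^ quarterTurn d' m), ← mul_assoc] at key
    have key := mul_right_cancel₀ (zpow_ne_zero _ lam_ne_zero) key
    have h0 : quarterTurn d' d' = 0 := by simp [quarterTurn]
    rw [h0, neg_zero, zpow_zero, mul_one]
    refine key.symm.trans ?_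
    change phase g (side p m) p T * _ = _
    rw [hphase, mul_assoc, ← zpow_add₀ lam_ne_zero, neg_add_cancel, zpow_zero, mul_one]
  · exact (turn d' hdd hd h.notMem).2

/-- The configuration that remains when a path is removed, and its phase. -/
theorem phase_path {F : Finset Face} {g q : Face} (hg : g ∉ F) {a z : GridEdge}
    {γ : Finset GridEdge} (hγ : γ ⊆ interiorEdges F) (hS : IsConfig g z q (insert a γ))
    (l : List Dir) : ∀ (p : Face) (d : Dir), p ∈ F → LeadsTo γ a z q p d l →
      (edgesAlong p l).Nodup → side p (d + 2) ∉ edgesAlong p l →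
      side p (d + 2) ∈ insert a γ →
      IsConfig g (side p (d + 2)) (step p (d + 2))
          ((insert a γ \ (edgesAlong p l).toFinset).erase (side p (d + 2))) ∧
        phase g z q (insert a γ) = phase g (side p (d + 2)) (step p (d + 2))
          ((insert a γ \ (edgesAlong p l).toFinset).erase (side p (d + 2))) *
            lam ^ (-quarterTurns d l) := by
  induction l with
  | nil => intro p d _ h; exact h.elim
  | cons d' l ih =>
    intro p d hp hl hnd he heS
    have hpg : p ≠ g := fun h => hg (h ▸ hp)
    have hne : d' ≠ d + 2 := by
      rintro rfl
      exact he (by simp [edgesAlong])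
    -- an unoccupied side, if the path goes straight on
    have hstr : TurnAllowed γ a z q p d d' → (side p d' ∈ γ ∨ (p = q ∧ side p d' = z)) →
        d' = d → ∃ m, m ≠ d ∧ m ≠ d + 2 ∧ side p m ∉ insert a γ := by
      intro ht hocc hdd
      obtain ⟨m, hm⟩ : ∃ m, ¬ Occupied γ a z q p m := by
        by_contra hcon
        push Not at hcon
        exact ht hcon hdd
      simp only [Occupied, not_or] at hm
      refine ⟨m, ?_, ?_, ?_⟩
      · rintro rfl
        rw [hdd] at hocc
        tauto
      · rintro rfl
        rw [Finset.mem_insert] at heS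
        tauto
      · rw [Finset.mem_insert]
        tauto
    cases l with
    | nil =>
      obtain ⟨rfl, rfl, ht⟩ := hl
      have hT : insert a γ \ (edgesAlong p [d']).toFinset = insert a γ := by
        rw [Finset.sdiff_eq_self_iff_disjoint]
        simpa [edgesAlong] using hS.notMem
      rw [hT]
      have := phase_step hpg hS heS hne (hstr ht (Or.inr ⟨rfl, rfl⟩))
      simpa [quarterTurns] using this
    | cons d'' l =>
      obtain ⟨hmem, ht, hl⟩ := hl
      have hnd' := List.nodup_cons.mp hnd
      rw [edgesAlong, List.mem_cons, not_or] at he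
      have hstep : step p d' ∈ F := by
        have := mem_interiorEdges.mp (hγ hmem)
        rcases leftFace_rightFace_side p d' with ⟨h₁, h₂⟩ | ⟨h₁, h₂⟩
        · exact h₂ ▸ this.2
        · exact h₁ ▸ this.1
      -- The path is retracted from its end: the induction hypothesis has already brought the end
      -- back to the side d' of `p`.
      have key := ih (step p d') d' hstep hl hnd'.2
      rw [side_step, step_step] at key
      obtain ⟨k₁, k₂⟩ := key hnd'.1 (Finset.mem_insert_of_mem hmem)
      have hT : (insert a γ \ (edgesAlong p (d' :: d'' :: l)).toFinset).erase (side p (d + 2)) =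
          ((insert a γ \ (edgesAlong (step p d') (d'' :: l)).toFinset).erase
            (side p d')).erase (side p (d + 2)) := by
        congr 1
        rw [edgesAlong, List.toFinset_cons, Finset.sdiff_insert]
      rw [hT]
      have heT : side p (d + 2) ∈ (insert a γ \
          (edgesAlong (step p d') (d'' :: l)).toFinset).erase (side p d') := by
        simp only [Finset.mem_erase, Finset.mem_sdiff, List.mem_toFinset]
        exact ⟨he.1, heS, he.2⟩
      obtain ⟨c₁, c₂⟩ := phase_step hpg k₁ heT hne fun hdd => by
        obtain ⟨m, h₁, h₂, h₃⟩ := hstr ht (Or.inl hmem) hdd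
        refine ⟨m, h₁, h₂, fun h => h₃ ?_⟩
        exact (Finset.mem_sdiff.mp (Finset.mem_of_mem_erase h)).1
      refine ⟨c₁, ?_⟩
      rw [k₂, c₂, mul_assoc, ← zpow_add₀ lam_ne_zero, ← neg_add]
      rfl

/-! ### The start of a path -/

theorem lam_sq : lam ^ 2 = Complex.I := by
  rw [lam, ← Complex.exp_nat_mul, show ((2 : ℕ) : ℂ) * (Complex.I * Real.pi / 4) =
    Real.pi / 2 * Complex.I by push_cast; ring, Complex.exp_pi_div_two_mul_I]

theorem mem_rootLine_of_sq_mul_eq_one {τ u : ℂ} (h : u ^ 2 * τ = 1) : u ∈ rootLine τ := by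
  have hτ : τ ≠ 0 := by rintro rfl; simp at h
  have h₂ : u ^ 2 = (τ ^ (-(1 / 2) : ℂ)) ^ 2 := by
    rw [cpow_neg_half_sq hτ, eq_inv_of_mul_eq_one_left h]
  rw [rootLine, Submodule.mem_span_singleton]
  rcases sq_eq_sq_iff_eq_or_eq_neg.mp h₂ with h | h
  · exact ⟨1, by rw [h, one_smul]⟩
  · exact ⟨-1, by rw [h, neg_smul, one_smul]⟩

theorem dirUnit_add_two_sq (d : Dir) : dirUnit (d + 2) ^ 2 = -dirUnit d ^ 2 := by
  have h := lam_sq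
  have h0 := lam_ne_zero
  fin_cases d <;> simp [dirUnit, dirExponent, lam_sq]

/-- The face on the outer side of a boundary edge. -/
def outerFace (F : Finset Face) (a : GridEdge) : Face :=
  if leftFace a ∈ F then rightFace a else leftFace a

section Entry

variable {F : Finset Face} {a : GridEdge}

theorem entry_mem (ha : a ∈ boundaryEdges F) : (entry F a).1 ∈ F := by
  have h := mem_boundaryEdges.mp ha
  cases a <;> simp only [entry] <;> split_ifs with hl <;> tauto

theorem side_entry (F : Finset Face) (a : GridEdge) :
    side (entry F a).1 ((entry F a).2 + 2) = a := by
  cases a <;> simp only [entry] <;> split_ifs <;> simp [side, leftFace, rightFace]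

theorem step_entry (F : Finset Face) (a : GridEdge) :
    step (entry F a).1 ((entry F a).2 + 2) = outerFace F a := by
  cases a <;> simp only [entry, outerFace] <;> split_ifs <;> simp [step, leftFace, rightFace]

theorem outerFace_notMem (ha : a ∈ boundaryEdges F) : outerFace F a ∉ F := by
  have h := mem_boundaryEdges.mp ha
  rw [outerFace]
  split_ifs <;> tauto

theorem dirUnit_entry_sq (F : Finset Face) (a : GridEdge) :
    dirUnit (entry F a).2 ^ 2 * tauCCW F a = 1 := by
  cases a <;> simp only [entry, tauCCW] <;> split_ifs <;>
    simp [dirUnit, dirExponent, tangent, lam_sq]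

end Entry

/-- No edge of `T` touches `g`, and the end coincides with the sink. In the strip that starts at `g`
the two sinks cancel, so the rays along its top and bottom have equal parity and only the height
term 1 survives. -/
theorem spin_start {F : Finset Face} {g : Face} (hg : g ∉ F) {d : Dir} {T : Finset GridEdge}
    (hT : T ⊆ interiorEdges F) (h : IsConfig g (side g d) g T) : spin g (side g d) g T = 1 := by
  have hside : ∀ d, side g d ∉ T := by
    intro d hd
    have := mem_interiorEdges.mp (hT hd)
    rcases leftFace_rightFace_side g d with ⟨h₁, h₂⟩ | ⟨h₁, h₂⟩
    · exact hg (h₁ ▸ this.1)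
    · exact hg (h₂ ▸ this.2)
  obtain ⟨X, Y⟩ := g
  have hs := h.strip X Y
  have h₁ := rayParity_succ T X (Y + 1)
  have h₂ := rayParity_succ T X Y
  rw [if_neg (show GridEdge.hor X (Y + 1) ∉ T from hside 1)] at h₁
  rw [if_neg (show GridEdge.hor X Y ∉ T from hside 3)] at h₂
  rw [if_neg (show GridEdge.ver X Y ∉ T from hside 2), if_pos (by simp)] at hs
  rw [add_zero] at h₁ h₂ hs
  have h0 : (1 : ZMod 2) + 1 = 0 := rfl
  rw [h0] at hs
  have e := eq_neg_of_add_eq_zero_left hs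
  rw [spin]
  fin_cases d <;> simp [side, rayBase, onLeftRay_hor, not_onLeftRay_ver, ← h₁, ← h₂, e,
    CharTwo.add_self_eq_zero]

/-! ### Existence of paths -/

/-- The edges and half-edges in `R`, with the half-edge from `q` to `z`. -/
def Remaining (R : Finset GridEdge) (z : GridEdge) (q p : Face) (d : Dir) : Prop :=
  side p d ∈ R ∨ (p = q ∧ side p d = z)

/-- At the faces where all directions are occupied, two remaining directions are never opposite
(the half-edge by which the path comes into the face `p` with direction `d` remains). -/
def NoCrossing (F : Finset Face) (γ : Finset GridEdge) (a z : GridEdge) (q : Face)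
    (R : Finset GridEdge) (p : Face) (d : Dir) : Prop :=
  ∀ f ∈ F, (∀ k, Occupied γ a z q f k) → ∀ k,
    (Remaining R z q f k ∨ (f = p ∧ k = d + 2)) →
    (Remaining R z q f (k + 2) ∨ (f = p ∧ k + 2 = d + 2)) →
    (Remaining R z q f (k + 1) ∨ (f = p ∧ k + 1 = d + 2)) ∨
      (Remaining R z q f (k + 3) ∨ (f = p ∧ k + 3 = d + 2))

open Classical in
theorem sum_remaining {R : Finset GridEdge} {z : GridEdge} {q : Face} (hzR : z ∉ R)
    (hq : q = leftFace z ∨ q = rightFace z) (p : Face) :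
    ∑ k, (if Remaining R z q p k then 1 else 0 : ZMod 2) =
      degree R p + if p = q then 1 else 0 := by
  obtain ⟨k₀, hk₀⟩ := (exists_side_eq_iff q z).mpr hq
  have h : ∀ k, (if Remaining R z q p k then 1 else 0 : ZMod 2) =
      (if side p k ∈ R then 1 else 0) + if p = q ∧ k = k₀ then 1 else 0 := by
    intro k
    by_cases hp : p = q
    · subst hp
      by_cases hk : k = k₀
      · subst hk
        simp [Remaining, hk₀, hzR]
      · have : side p k ≠ z := fun h => hk (side_injective p (h.trans hk₀.symm))
        simp [Remaining, hk, this]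
    · simp [Remaining, hp]
  rw [Finset.sum_congr rfl fun k _ => h k, Finset.sum_add_distrib, degree_eq_sum]
  congr 1
  by_cases hp : p = q <;> simp [hp]

theorem sum_dir (f : Dir → ZMod 2) (d : Dir) :
    ∑ k, f k = f d + f (d + 1) + f (d + 2) + f (d + 3) := by
  rw [Fin.sum_univ_four]
  fin_cases d <;> simp <;> ring

theorem dir_arith : ∀ d : Dir, (∀ k : Dir, k = d ∨ k = d + 1 ∨ k = d + 2 ∨ k = d + 3) ∧
    d + 1 ≠ d ∧ d + 3 ≠ d ∧ d + 3 + 2 = d + 1 ∧ d + 1 ≠ d + 2 ∧ d + 3 ≠ d + 2 := by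
  decide

open Classical in
/-- The choice of the next direction of a path. -/
theorem exists_next {F : Finset Face} {γ R : Finset GridEdge} {a z : GridEdge} {q p : Face}
    {d : Dir} (hzR : z ∉ R) (hq : q = leftFace z ∨ q = rightFace z) (hp : p ∈ F)
    (he : side p (d + 2) ∉ R) (hez : side p (d + 2) ≠ z)
    (hpar : (degree R p : ZMod 2) + (if p = q then 1 else 0) + 1 = 0)
    (hnc : NoCrossing F γ a z q R p d) :
    ∃ d', Remaining R z q p d' ∧ TurnAllowed γ a z q p d d' ∧
      ∀ k, Remaining R z q p k → Remaining R z q p (k + 2) → k = d' ∨ k + 2 = d' := by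
  have h₀ : ¬ Remaining R z q p (d + 2) := by
    rintro (h | h)
    · exact he h
    · exact hez h.2
  have hsum := sum_remaining hzR hq p
  rw [sum_dir _ d, if_neg h₀, add_zero] at hsum
  rw [← hsum] at hpar
  obtain ⟨hk, e₁, e₃, e₆, f₁, f₃⟩ := dir_arith d
  -- The entry direction is used up, so parity leaves one or three of the other directions.
  by_cases r₁ : Remaining R z q p (d + 1) <;> by_cases r₃ : Remaining R z q p (d + 3) <;>
    by_cases r : Remaining R z q p d
  all_goals simp only [r, r₁, r₃, if_true, if_false] at hpar
  all_goals first
    | exact absurd hpar (by decide)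
    | skip
  · refine ⟨d + 1, r₁, fun _ => e₁, fun k h h' => ?_⟩
    rcases hk k with rfl | rfl | rfl | rfl
    · exact absurd h' h₀
    · exact Or.inl rfl
    · exact absurd h h₀
    · exact Or.inr e₆
  · refine ⟨d + 1, r₁, fun _ => e₁, fun k h h' => ?_⟩
    rcases hk k with rfl | rfl | rfl | rfl
    · exact absurd h r
    · exact Or.inl rfl
    · exact absurd h h₀
    · exact absurd h r₃
  · refine ⟨d + 3, r₃, fun _ => e₃, fun k h h' => ?_⟩
    rcases hk k with rfl | rfl | rfl | rfl
    · exact absurd h r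
    · exact absurd h r₁
    · exact absurd h h₀
    · exact Or.inl rfl
  -- Only the way straight on is left. At a full face this would be an opposite pair with both
  -- lateral directions gone, which `NoCrossing` excludes.
  · refine ⟨d, r, fun hfull => ?_, fun k h h' => ?_⟩
    · exfalso
      have := hnc p hp hfull d (Or.inl r) (Or.inr ⟨rfl, rfl⟩)
      tauto
    · rcases hk k with rfl | rfl | rfl | rfl
      · exact Or.inl rfl
      · exact absurd h r₁
      · exact absurd h h₀
      · exact absurd h r₃

/-- A greedy walk on the remaining edges `R`: parity prevents it from getting stuck before `z`, and
`exists_next` breaks any opposite pair at the face left behind, so `NoCrossing` persists. The number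
of remaining edges decreases. -/
theorem exists_leadsTo {F : Finset Face} {γ : Finset GridEdge} {a z : GridEdge} {q : Face}
    (hγ : γ ⊆ interiorEdges F) (hzγ : z ∉ γ) (hq : q = leftFace z ∨ q = rightFace z) :
    ∀ (n : ℕ) (R : Finset GridEdge) (p : Face) (d : Dir), R.card = n → R ⊆ γ → p ∈ F →
      side p (d + 2) ∉ R → side p (d + 2) ≠ z →
      (∀ f ∈ F, (degree R f : ZMod 2) + (if f = q then 1 else 0) + (if f = p then 1 else 0) = 0) →
      NoCrossing F γ a z q R p d →
      ∃ l, LeadsTo γ a z q p d l ∧ (edgesAlong p l).Nodup ∧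
        ∀ e ∈ edgesAlong p l, e ∈ R ∨ e = z := by
  intro n
  induction n with
  | zero =>
    intro R p d hn hR hp he hez hpar hnc
    obtain rfl := Finset.card_eq_zero.mp hn
    have hp' := hpar p hp
    rw [if_pos rfl] at hp'
    obtain ⟨d', h₁, h₂, -⟩ := exists_next (fun h => hzγ (hR h)) hq hp he hez hp' hnc
    have h₁ := h₁.resolve_left (by simp)
    exact ⟨[d'], ⟨h₁.1, h₁.2, h₂⟩, by simp [edgesAlong], by simp [edgesAlong, h₁.2]⟩
  | succ n ih =>
    intro R p d hn hR hp he hez hpar hnc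
    have hzR : z ∉ R := fun h => hzγ (hR h)
    have hp' := hpar p hp
    rw [if_pos rfl] at hp'
    obtain ⟨d', h₁, h₂, h₃⟩ := exists_next hzR hq hp he hez hp' hnc
    rcases h₁ with h₁ | h₁
    swap
    · exact ⟨[d'], ⟨h₁.1, h₁.2, h₂⟩, by simp [edgesAlong], by simp [edgesAlong, h₁.2]⟩
    have hstep : step p d' ∈ F := by
      have := mem_interiorEdges.mp (hγ (hR h₁))
      rcases leftFace_rightFace_side p d' with ⟨a₁, a₂⟩ | ⟨a₁, a₂⟩
      · exact a₂ ▸ this.2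
      · exact a₁ ▸ this.1
    have hnp := step_ne p d'
    have hins : insert (side p d') (R.erase (side p d')) = R := Finset.insert_erase h₁
    obtain ⟨l, hl₁, hl₂, hl₃⟩ := ih (R.erase (side p d')) (step p d') d'
      (by rw [Finset.card_erase_of_mem h₁, hn]; rfl)
      ((Finset.erase_subset _ _).trans hR) hstep
      (by rw [side_step]; exact Finset.notMem_erase _ _)
      (by rw [side_step]; exact fun h => hzR (h ▸ h₁))
      (fun f hf => by
        have := hpar f hf
        rw [← hins, degree_insert (Finset.notMem_erase _ _)] at this
        have h0 : (2 : ZMod 2) = 0 := rfl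
        linear_combination this - (if f = p then 1 else 0) * h0)
      (by
        -- the remaining directions
        have hrem : ∀ f k, (Remaining (R.erase (side p d')) z q f k ∨
            (f = step p d' ∧ k = d' + 2)) ↔ (Remaining R z q f k ∧ ¬ (f = p ∧ k = d')) := by
          intro f k
          have hs := @side_eq_side_iff p f d' k
          have hzs : side p d' ≠ z := fun h => hzR (h ▸ h₁)
          simp only [Remaining, Finset.mem_erase, ne_eq]
          constructor
          · rintro ((h | h) | ⟨rfl, rfl⟩)
            · exact ⟨Or.inl h.2, fun h' => h.1 (hs.mpr (Or.inl h'))⟩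
            · refine ⟨Or.inr h, ?_⟩
              rintro ⟨rfl, rfl⟩
              exact hzs h.2
            · rw [side_step]
              exact ⟨Or.inl h₁, fun h => hnp h.1⟩
          · rintro ⟨h | h, h'⟩
            · by_cases hsd : side f k = side p d'
              · exact Or.inr ((hs.mp hsd).resolve_left h')
              · exact Or.inl (Or.inl ⟨hsd, h⟩)
            · exact Or.inl (Or.inr h)
        intro f hf hfull k
        rw [hrem, hrem, hrem, hrem]
        rintro ⟨k₁, k₂⟩ ⟨k₃, k₄⟩
        by_cases hfp : f = p
        · subst hfp
          rcases h₃ k k₁ k₃ with h | h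
          · exact absurd ⟨rfl, h⟩ k₂
          · exact absurd ⟨rfl, h⟩ k₄
        · have := hnc f hf hfull k (Or.inl k₁) (Or.inl k₃)
          tauto)
    cases l with
    | nil => exact hl₁.elim
    | cons d'' l =>
      refine ⟨d' :: d'' :: l, ⟨hR h₁, h₂, hl₁⟩, ?_, ?_⟩
      · rw [edgesAlong, List.nodup_cons]
        refine ⟨fun h => ?_, hl₂⟩
        rcases hl₃ _ h with h | h
        · exact Finset.notMem_erase _ _ h
        · exact hzR (h ▸ h₁)
      · intro e he
        rw [edgesAlong, List.mem_cons] at he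
        rcases he with rfl | he
        · exact Or.inl h₁
        · exact (hl₃ e he).imp_left Finset.mem_of_mem_erase

/-! ### The observable as a sum over configurations -/

/-- The edges that configurations may use. -/
def allowedEdges (F : Finset Face) (a : GridEdge) : Finset GridEdge := insert a (interiorEdges F)

open Classical in
/-- The configurations that end at `z`, with the face from which they come to `z`. -/
noncomputable def configs (F : Finset Face) (a z : GridEdge) :
    Finset (Face × Finset GridEdge) :=
  ((({leftFace z, rightFace z} : Finset Face).filter fun q => q ∈ F ∨ z = a) ×ˢ
    (allowedEdges F a).powerset).filter fun c => IsConfig (outerFace F a) z c.1 c.2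

theorem mem_configs {F : Finset Face} {a z : GridEdge} {c : Face × Finset GridEdge} :
    c ∈ configs F a z ↔ ((c.1 = leftFace z ∨ c.1 = rightFace z) ∧ (c.1 ∈ F ∨ z = a)) ∧
      c.2 ⊆ allowedEdges F a ∧ IsConfig (outerFace F a) z c.1 c.2 := by
  simp [configs, and_assoc]

theorem face_of_mem {z : GridEdge} {p : Face} {d : Dir} (h : side p d = z) (q : Face) :
    (q = leftFace z ∨ q = rightFace z) ↔ (q = p ∨ q = step p d) := by
  rcases leftFace_rightFace_side p d with ⟨h₁, h₂⟩ | ⟨h₁, h₂⟩ <;> rw [← h, h₁, h₂]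
  exact or_comm

theorem degree_eq_zero {F : Finset Face} {S : Finset GridEdge} (hS : S ⊆ interiorEdges F)
    {p : Face} (hp : p ∉ F) : degree S p = 0 := by
  rw [degree, Finset.card_eq_zero, Finset.filter_eq_empty_iff]
  intro d _ hd
  have := mem_interiorEdges.mp (hS hd)
  rcases leftFace_rightFace_side p d with ⟨h₁, h₂⟩ | ⟨h₁, h₂⟩
  · exact hp (h₁ ▸ this.1)
  · exact hp (h₂ ▸ this.2)

theorem mem_edgesAlong_of_leadsTo {γ : Finset GridEdge} {a z : GridEdge} {q : Face}
    (l : List Dir) : ∀ (p : Face) (d : Dir), LeadsTo γ a z q p d l →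
      ∀ e ∈ edgesAlong p l, e ∈ γ ∨ e = z := by
  induction l with
  | nil => simp [edgesAlong]
  | cons d' l ih =>
    intro p d hl e he
    rw [edgesAlong, List.mem_cons] at he
    cases l with
    | nil =>
      obtain ⟨-, rfl, -⟩ := hl
      exact Or.inr (he.resolve_right (by simp [edgesAlong]))
    | cons d'' l =>
      rcases he with rfl | he
      · exact Or.inl hl.1
      · exact ih _ _ hl.2.2 e he

section

variable {F : Finset Face} {a : GridEdge}

theorem notMem_interiorEdges_of_boundary (ha : a ∈ boundaryEdges F) : a ∉ interiorEdges F := by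
  have := mem_boundaryEdges.mp ha
  rw [mem_interiorEdges]
  tauto

theorem degree_insert_boundary (ha : a ∈ boundaryEdges F) {γ : Finset GridEdge}
    (hγ : γ ⊆ interiorEdges F) (p : Face) : (degree (insert a γ) p : ZMod 2) =
      degree γ p + (if p = (entry F a).1 then 1 else 0) +
        (if p = outerFace F a then 1 else 0) := by
  have h := side_entry F a
  have haγ : side (entry F a).1 ((entry F a).2 + 2) ∉ γ := by
    rw [h]
    exact fun h => notMem_interiorEdges_of_boundary ha (hγ h)
  have := degree_insert haγ p
  rwa [h, step_entry] at this

/-- Adding `a` as a full edge moves the source from the entry face to the outer face, so that it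
becomes an ordinary sink outside of the domain. -/
theorem isConfig_insert (ha : a ∈ boundaryEdges F) {z : GridEdge} (hza : z ≠ a) {q : Face}
    (hq : q ∈ F) {γ : Finset GridEdge} (hγ : γ ⊆ interiorEdges F) :
    IsConfig (outerFace F a) z q (insert a γ) ↔ z ∉ γ ∧ ∀ p ∈ F,
      Even (degree γ p + (if p = (entry F a).1 then 1 else 0) + (if p = q then 1 else 0)) := by
  have h0 : (2 : ZMod 2) = 0 := rfl
  have hp : ∀ p, ((degree (insert a γ) p : ZMod 2) + (if p = q then 1 else 0) +
      (if p = outerFace F a then 1 else 0) = 0 ↔ (p ∈ F →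
      Even (degree γ p + (if p = (entry F a).1 then 1 else 0) + (if p = q then 1 else 0)))) := by
    intro p
    rw [degree_insert_boundary ha hγ, ← ZMod.natCast_eq_zero_iff_even]
    push_cast
    by_cases hpF : p ∈ F
    · simp only [hpF, true_imp_iff]
      constructor <;> intro h
      · linear_combination h - (if p = outerFace F a then 1 else 0) * h0
      · linear_combination h + (if p = outerFace F a then 1 else 0) * h0
    · have h₁ : p ≠ (entry F a).1 := fun h => hpF (h ▸ entry_mem ha)
      have h₂ : p ≠ q := fun h => hpF (h ▸ hq)
      simp only [hpF, degree_eq_zero hγ hpF, h₁, h₂, if_false, false_imp_iff, iff_true]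
      split_ifs <;> rfl
  constructor
  · intro h
    exact ⟨fun hz => h.notMem (Finset.mem_insert_of_mem hz), fun p => (hp p).mp (h.parity p)⟩
  · rintro ⟨h₁, h₂⟩
    exact ⟨by simp [hza, h₁], fun p => (hp p).mpr (h₂ p)⟩

theorem mem_pathConfigs (ha : a ∈ boundaryEdges F) {z : GridEdge} (hza : z ≠ a) {q : Face}
    (hq : q ∈ F) {γ : Finset GridEdge} : γ ∈ pathConfigs F a z q ↔
      γ ⊆ interiorEdges F ∧ IsConfig (outerFace F a) z q (insert a γ) := by
  rw [pathConfigs, Finset.mem_filter, Finset.mem_powerset, Finset.subset_erase, and_assoc]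
  constructor
  · rintro ⟨h₁, h₂⟩
    exact ⟨h₁, (isConfig_insert ha hza hq h₁).mpr h₂⟩
  · rintro ⟨h₁, h₂⟩
    exact ⟨h₁, (isConfig_insert ha hza hq h₁).mp h₂⟩

/-- The value of `phase` when the path has been retracted to its source; the minus sign is the one
from `spin_start`. -/
theorem phase_start (ha : a ∈ boundaryEdges F) {T : Finset GridEdge} (hT : T ⊆ interiorEdges F)
    (h : IsConfig (outerFace F a) a (outerFace F a) T) :
    phase (outerFace F a) a (outerFace F a) T = -dirUnit (entry F a).2 := by
  have h₃ : (entry F a).2 + 2 + 2 = (entry F a).2 := by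
    generalize (entry F a).2 = d
    revert d; decide
  have e := side_step (entry F a).1 ((entry F a).2 + 2)
  rw [step_entry, side_entry, h₃] at e
  have h₁ := spin_start (d := (entry F a).2) (outerFace_notMem ha) hT (by rwa [e])
  rw [e] at h₁
  have h₂ := arrival_far (entry F a).1 ((entry F a).2 + 2)
  rw [side_entry, step_entry] at h₂
  rw [phase, h₁, h₂, h₃]
  simp [sgn]

/-- Retracting the path by `phase_path` collects its total turn and ends at the constant of
`phase_start`. -/
theorem windingPhase_eq (ha : a ∈ boundaryEdges F) {z : GridEdge} (hza : z ≠ a) {q : Face}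
    (hq : q ∈ F) (hqz : q = leftFace z ∨ q = rightFace z) {γ : Finset GridEdge}
    (hγ : γ ∈ pathConfigs F a z q) :
    windingPhase F γ a z q =
      phase (outerFace F a) z q (insert a γ) * (-dirUnit (entry F a).2)⁻¹ := by
  obtain ⟨hγF, hS⟩ := (mem_pathConfigs ha hza hq).mp hγ
  have hpar := ((isConfig_insert ha hza hq hγF).mp hS)
  have haγ : a ∉ γ := fun h => notMem_interiorEdges_of_boundary ha (hγF h)
  have hside := side_entry F a
  have hex : ∃ l, IsPathIn F γ a z q l := by
    obtain ⟨l, h₁, h₂, -⟩ := exists_leadsTo (a := a) hγF hpar.1 hqz γ.card γ (entry F a).1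
      (entry F a).2 rfl subset_rfl (entry_mem ha) (by rwa [hside]) (by rw [hside]; exact hza.symm)
      (fun f hf => by
        have := ZMod.natCast_eq_zero_iff_even.mpr (hpar.2 f hf)
        push_cast at this
        linear_combination this)
      (by
        -- Before the walk starts, every direction at a full face remains, so `NoCrossing` holds.
        have hrem : ∀ f ∈ F, (∀ k, Occupied γ a z q f k) → ∀ k, Remaining γ z q f k ∨
            (f = (entry F a).1 ∧ k = (entry F a).2 + 2) := by
          intro f hf hfull k
          rcases hfull k with h | h | h
          · exact Or.inl (Or.inl h)
          · rw [← hside] at h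
            rcases side_eq_side_iff.mp h with h | ⟨h, -⟩
            · exact Or.inr h
            · rw [step_entry] at h
              exact absurd (h ▸ hf) (outerFace_notMem ha)
          · exact Or.inl (Or.inr h)
        intro f hf hfull k _ _
        exact Or.inl (hrem f hf hfull (k + 1)))
    exact ⟨l, h₁, h₂⟩
  rw [windingPhase, dif_pos hex]
  obtain ⟨hl, hnd⟩ := hex.choose_spec
  -- Nothing but admissibility of the chosen path is used from here on, so the phase is independent
  -- of the choice.
  generalize hex.choose = l at hl hnd ⊢
  have hal : a ∉ edgesAlong (entry F a).1 l := fun h =>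
    (mem_edgesAlong_of_leadsTo l _ _ hl a h).elim haγ hza.symm
  obtain ⟨c₁, c₂⟩ := phase_path (outerFace_notMem ha) hγF hS l _ _ (entry_mem ha) hl hnd
    (by rwa [hside]) (by rw [hside]; exact Finset.mem_insert_self _ _)
  rw [hside, step_entry] at c₁ c₂
  have hT : (insert a γ \ (edgesAlong (entry F a).1 l).toFinset).erase a ⊆ interiorEdges F := by
    intro e he
    have := Finset.mem_of_mem_erase he
    have := Finset.mem_insert.mp (Finset.mem_sdiff.mp this).1
    exact hγF (this.resolve_left (Finset.ne_of_mem_erase he))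
  rw [phase_start ha hT c₁] at c₂
  rw [c₂, mul_comm (-dirUnit _), mul_inv_cancel_right₀ (neg_ne_zero.mpr (dirUnit_ne_zero _)),
    lam_zpow]
  congr 1
  push_cast
  ring

/-- The sum of the weights of all configurations that end at `z`. -/
noncomputable def configSum (F : Finset Face) (a z : GridEdge) : ℂ :=
  ∑ c ∈ configs F a z,
    (criticalWeight : ℂ) ^ c.2.card * phase (outerFace F a) z c.1 c.2

theorem configSum_of_ne (ha : a ∈ boundaryEdges F) {z : GridEdge} (hza : z ≠ a) :
    configSum F a z = ∑ q ∈ ({leftFace z, rightFace z} : Finset Face).filter (· ∈ F),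
      ∑ γ ∈ pathConfigs F a z q,
        (criticalWeight : ℂ) ^ (γ.card + 1) * phase (outerFace F a) z q (insert a γ) := by
  classical
  rw [configSum, configs, Finset.sum_filter, Finset.sum_product]
  simp only [hza, or_false]
  refine Finset.sum_congr rfl fun q hq => ?_
  have hqF : q ∈ F := (Finset.mem_filter.mp hq).2
  rw [← Finset.sum_filter]
  refine (Finset.sum_bij (fun γ _ => insert a γ) ?_ ?_ ?_ ?_).symm
  · intro γ hγ
    obtain ⟨h₁, h₂⟩ := (mem_pathConfigs ha hza hqF).mp hγ
    exact Finset.mem_filter.mpr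
      ⟨Finset.mem_powerset.mpr (Finset.insert_subset_insert a h₁), h₂⟩
  · intro γ hγ γ' hγ' h
    have n : ∀ γ ∈ pathConfigs F a z q, a ∉ γ := fun γ hγ h =>
      notMem_interiorEdges_of_boundary ha (((mem_pathConfigs ha hza hqF).mp hγ).1 h)
    rw [← Finset.erase_insert (n γ hγ), ← Finset.erase_insert (n γ' hγ'), h]
  · intro S hS
    obtain ⟨h₁, h₂⟩ := Finset.mem_filter.mp hS
    have h₁ := Finset.mem_powerset.mp h₁
    have hsub : S.erase a ⊆ interiorEdges F := fun e he =>
      (Finset.mem_insert.mp (h₁ (Finset.mem_of_mem_erase he))).resolve_left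
        (Finset.ne_of_mem_erase he)
    -- Only `a` can give the outer face its odd degree.
    have haS : a ∈ S := by
      by_contra haS
      rw [Finset.erase_eq_of_notMem haS] at hsub
      have := h₂.parity (outerFace F a)
      rw [degree_eq_zero hsub (outerFace_notMem ha), if_pos rfl,
        if_neg fun h : outerFace F a = q => outerFace_notMem ha (h ▸ hqF)] at this
      exact absurd this (by decide)
    refine ⟨S.erase a, (mem_pathConfigs ha hza hqF).mpr ⟨hsub, ?_⟩, Finset.insert_erase haS⟩
    rwa [Finset.insert_erase haS]
  · intro γ hγ
    have n : a ∉ γ := fun h =>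
      notMem_interiorEdges_of_boundary ha (((mem_pathConfigs ha hza hqF).mp hγ).1 h)
    rw [Finset.card_insert_of_notMem n]

theorem outerFace_adjacent (F : Finset Face) (a : GridEdge) :
    outerFace F a = leftFace a ∨ outerFace F a = rightFace a := by
  rw [outerFace]; split_ifs <;> simp

/-- A configuration that ends at `a` does not contain `a`. Parity at the outer face then forces the
end to lie there, and a collection of loops is left. -/
theorem configSum_self (ha : a ∈ boundaryEdges F) :
    configSum F a a = partitionFunction F * -dirUnit (entry F a).2 := by
  rw [configSum, partitionFunction]
  push_cast
  rw [Finset.sum_mul]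
  have h0 : (1 : ZMod 2) + 1 = 0 := rfl
  refine (Finset.sum_bij (fun ω _ => (outerFace F a, ω)) ?_ ?_ ?_ ?_).symm
  · intro ω hω
    obtain ⟨h₁, h₂⟩ := Finset.mem_filter.mp hω
    have h₁ := Finset.mem_powerset.mp h₁
    refine mem_configs.mpr ⟨⟨outerFace_adjacent F a, Or.inr rfl⟩,
      h₁.trans (Finset.subset_insert _ _),
      fun h => notMem_interiorEdges_of_boundary ha (h₁ h), fun p => ?_⟩
    by_cases hp : p ∈ F
    · rw [ZMod.natCast_eq_zero_iff_even.mpr (h₂ p hp),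
        if_neg fun h : p = outerFace F a => outerFace_notMem ha (h ▸ hp)]
      rfl
    · rw [degree_eq_zero h₁ hp]
      split_ifs <;> rfl
  · intro ω _ ω' _ h
    exact (Prod.ext_iff.mp h).2
  · rintro ⟨q, S⟩ hc
    obtain ⟨⟨hq, -⟩, hS, hc⟩ := mem_configs.mp hc
    simp only at hq hS hc
    have hsub : S ⊆ interiorEdges F := fun e he =>
      (Finset.mem_insert.mp (hS he)).resolve_left fun h => hc.notMem (h ▸ he)
    have hqg : q = outerFace F a := by
      have := hc.parity (outerFace F a)
      rw [degree_eq_zero hsub (outerFace_notMem ha), if_pos rfl] at this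
      by_contra hne
      rw [if_neg (Ne.symm hne)] at this
      exact absurd this (by decide)
    subst hqg
    refine ⟨S, Finset.mem_filter.mpr ⟨Finset.mem_powerset.mpr hsub, fun p hp => ?_⟩, rfl⟩
    have := hc.parity p
    rw [if_neg fun h : p = outerFace F a => outerFace_notMem ha (h ▸ hp), add_zero, add_zero] at this
    exact ZMod.natCast_eq_zero_iff_even.mp this
  · intro ω hω
    obtain ⟨h₁, h₂⟩ := Finset.mem_filter.mp hω
    have h₁ := Finset.mem_powerset.mp h₁
    rw [phase_start ha h₁]
    refine ⟨fun h => notMem_interiorEdges_of_boundary ha (h₁ h), fun p => ?_⟩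
    by_cases hp : p ∈ F
    · rw [ZMod.natCast_eq_zero_iff_even.mpr (h₂ p hp),
        if_neg fun h : p = outerFace F a => outerFace_notMem ha (h ▸ hp)]
      rfl
    · rw [degree_eq_zero h₁ hp]
      split_ifs <;> rfl

theorem partitionFunction_pos (F : Finset Face) : 0 < partitionFunction F := by
  refine Finset.sum_pos (fun ω _ => pow_pos (Real.exp_pos _) _) ⟨∅, ?_⟩
  exact Finset.mem_filter.mpr ⟨by simp, fun p _ => by simp [degree]⟩

theorem observable_eq (ha : a ∈ boundaryEdges F) (z : GridEdge) :
    observable F a z =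
      configSum F a z * (-dirUnit (entry F a).2)⁻¹ * (partitionFunction F : ℂ)⁻¹ := by
  have hd := neg_ne_zero.mpr (dirUnit_ne_zero (entry F a).2)
  have hZ : (partitionFunction F : ℂ) ≠ 0 :=
    Complex.ofReal_ne_zero.mpr (partitionFunction_pos F).ne'
  by_cases hza : z = a
  · subst hza
    rw [configSum_self ha, observable, if_pos rfl, mul_inv_cancel_right₀ hd, mul_inv_cancel₀ hZ]
  · rw [configSum_of_ne ha hza, observable, if_neg hza, div_eq_mul_inv]
    congr 1
    rw [Finset.sum_mul]
    refine Finset.sum_congr rfl fun q hq => ?_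
    rw [Finset.sum_mul]
    obtain ⟨hq, hqF⟩ := Finset.mem_filter.mp hq
    refine Finset.sum_congr rfl fun γ hγ => ?_
    rw [windingPhase_eq ha hza hqF (by simpa using hq) hγ, mul_assoc]

end

/-! ### The bijection of configurations at a corner -/

/-- The configuration with the ends of two sides of a face exchanged. -/
def swapConfig (p : Face) (d d' : Dir) (c : Face × Finset GridEdge) : Face × Finset GridEdge :=
  (if side p d' ∈ c.2 then step p d' else p,
    if c.1 = p then c.2.erase (side p d') else insert (side p d) (c.2.erase (side p d')))

theorem swapConfig_mk {p : Face} {d d' : Dir} {B : Finset GridEdge} {β β' : Bool}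
    (h' : side p d' ∉ B) :
    swapConfig p d d' (farFace p d β, adjoin B β' (side p d')) =
      (farFace p d' β', adjoin B β (side p d)) := by
  have hn := step_ne p d
  cases β <;> cases β' <;> simp [swapConfig, farFace, adjoin, h', hn]

theorem step_mem_iff {F : Finset Face} {p : Face} (hp : p ∈ F) (d : Dir) :
    step p d ∈ F ↔ side p d ∈ interiorEdges F := by
  rw [mem_interiorEdges]
  rcases leftFace_rightFace_side p d with ⟨h₁, h₂⟩ | ⟨h₁, h₂⟩ <;> rw [h₁, h₂] <;> tauto

/-- The membership condition treats (d, β) and (d', β') alike, which is why the exchange of the two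
sides preserves it. -/
theorem mem_configs_mk {F : Finset Face} {a : GridEdge} {p : Face} (hp : p ∈ F) {d d' : Dir}
    {B : Finset GridEdge} {β β' : Bool} :
    (farFace p d β, adjoin B β' (side p d')) ∈ configs F a (side p d) ↔
      ((β → side p d ∈ allowedEdges F a) ∧ (β' → side p d' ∈ allowedEdges F a) ∧
        B ⊆ allowedEdges F a) ∧
      IsConfig (outerFace F a) (side p d) (farFace p d β) (adjoin B β' (side p d')) := by
  rw [mem_configs, ← and_assoc, face_of_mem rfl]
  refine and_congr_left fun _ => ?_
  have h := step_mem_iff hp d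
  cases β <;> cases β' <;>
    simp [farFace, adjoin, hp, allowedEdges, Finset.insert_subset_iff, h, or_comm]

theorem exists_of_mem_configs {F : Finset Face} {a : GridEdge} {p : Face} {d d' : Dir}
    {c : Face × Finset GridEdge} (hc : c ∈ configs F a (side p d)) :
    ∃ β β' B, side p d ∉ B ∧ side p d' ∉ B ∧
      c = (farFace p d β, adjoin B β' (side p d')) := by
  obtain ⟨q, S⟩ := c
  obtain ⟨⟨hq, -⟩, -, hS⟩ := mem_configs.mp hc
  rw [face_of_mem rfl] at hq
  refine ⟨decide (q ≠ p), decide (side p d' ∈ S), S.erase (side p d'),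
    fun h => hS.notMem (Finset.mem_of_mem_erase h), Finset.notMem_erase _ _, ?_⟩
  refine Prod.ext ?_ ?_
  · rcases hq with h | h
    · simp only at h; simp [farFace, h]
    · simp only at h; simp [farFace, h, step_ne]
  · by_cases h : side p d' ∈ S
    · simp [adjoin, h]
    · simp [adjoin, h]

theorem swapConfig_mem {F : Finset Face} {a : GridEdge} {p : Face} (hp : p ∈ F) {d d' : Dir}
    (hd : d ≠ d') {c : Face × Finset GridEdge} (hc : c ∈ configs F a (side p d)) :
    swapConfig p d d' c ∈ configs F a (side p d') ∧
      swapConfig p d' d (swapConfig p d d' c) = c := by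
  obtain ⟨β, β', B, h₁, h₂, rfl⟩ := exists_of_mem_configs (d' := d') hc
  rw [swapConfig_mk h₂, swapConfig_mk h₁]
  rw [mem_configs_mk hp] at hc ⊢
  exact ⟨⟨⟨hc.1.2.1, hc.1.1, hc.1.2.2⟩, hc.2.swap hd h₁ h₂⟩, rfl⟩

theorem sum_configs_eq {M : Type*} [AddCommMonoid M] {F : Finset Face} {a : GridEdge} {p : Face}
    (hp : p ∈ F) {d d' : Dir} (hd : d ≠ d') {f f' : Face × Finset GridEdge → M}
    (h : ∀ (β β' : Bool) B, side p d ∉ B → side p d' ∉ B →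
      IsConfig (outerFace F a) (side p d) (farFace p d β) (adjoin B β' (side p d')) →
      f (farFace p d β, adjoin B β' (side p d')) = f' (farFace p d' β', adjoin B β (side p d))) :
    ∑ c ∈ configs F a (side p d), f c = ∑ c ∈ configs F a (side p d'), f' c := by
  refine Finset.sum_bij' (fun c _ => swapConfig p d d' c) (fun c _ => swapConfig p d' d c)
    (fun c hc => (swapConfig_mem hp hd hc).1) (fun c hc => (swapConfig_mem hp hd.symm hc).1)
    (fun c hc => (swapConfig_mem hp hd hc).2) (fun c hc => (swapConfig_mem hp hd.symm hc).2) ?_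
  intro c hc
  obtain ⟨β, β', B, h₁, h₂, rfl⟩ := exists_of_mem_configs (d' := d') hc
  rw [swapConfig_mk h₂]
  exact h β β' B h₁ h₂ (mem_configs.mp hc).2.2

/-! ### S-holomorphicity of the observable -/

theorem criticalWeight_eq : criticalWeight = √2 - 1 := by
  have h : (0 : ℝ) < √2 + 1 := by positivity
  have hs : √2 * √2 = (2 : ℝ) := Real.mul_self_sqrt (by norm_num)
  rw [criticalWeight, show -2 * (1 / 2 * Real.log (√2 + 1)) = -Real.log (√2 + 1) by ring,
    Real.exp_neg, Real.exp_log h]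
  exact inv_eq_of_mul_eq_one_right (by linear_combination hs)

theorem lam_zpow_values : lam ^ (0 : ℤ) = 1 ∧ lam ^ (1 : ℤ) = ⟨√2 / 2, √2 / 2⟩ ∧
    lam ^ (2 : ℤ) = Complex.I ∧ lam ^ (3 : ℤ) = ⟨-(√2 / 2), √2 / 2⟩ ∧
    lam ^ (-1 : ℤ) = ⟨√2 / 2, -(√2 / 2)⟩ ∧ lam ^ (-2 : ℤ) = -Complex.I ∧
    lam ^ (-3 : ℤ) = ⟨-(√2 / 2), -(√2 / 2)⟩ := by
  refine ⟨zpow_zero _, (zpow_one _).trans lam_eq, ?_, ?_, ?_, ?_, ?_⟩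
  · exact_mod_cast lam_sq
  · exact_mod_cast lam_cube_eq
  · rw [zpow_neg_one, lam_inv_eq]
  · rw [zpow_neg, show lam ^ (2 : ℤ) = Complex.I by exact_mod_cast lam_sq, Complex.inv_I]
  · rw [zpow_neg, ← lam_cube_inv_eq]
    norm_cast

/-- The projection to the line of a corner, up to a factor. -/
noncomputable def cornerProj (k : Fin 4) : ℂ →ₗ[ℝ] ℂ where
  toFun x := x + (corner k).2.2 * star x
  map_add' x y := by rw [star_add]; ring
  map_smul' r x := by
    simp only [star_smul, star_trivial, RingHom.id_apply, smul_add, mul_smul_comm]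

theorem cornerProj_apply (k : Fin 4) (x : ℂ) :
    cornerProj k x = x + (corner k).2.2 * star x := rfl

theorem corner_sides (k : Fin 4) : (corner k).1 ≠ (corner k).2.1 := by
  fin_cases k <;> simp [corner]

/-- The projections of the phases for near and far arrivals are parallel, with ratio tan(π/8). At
criticality this is the weight of the additional edge. -/
theorem cornerProj_lam (k : Fin 4) : ∃ C : ℂ, ∀ d, (d = (corner k).1 ∨ d = (corner k).2.1) →
    ∀ β : Bool, cornerProj k (lam ^ (1 - cornerLift k (arrivalDir d β))) =
      criticalWeight ^ β.toNat • C := by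
  obtain ⟨v0, v1, v2, v3, w1, w2, w3⟩ := lam_zpow_values
  have hs := half_sqrt_two_sq
  have hw : criticalWeight = 2 * (√2 / 2) - 1 := by rw [criticalWeight_eq]; ring
  refine ⟨cornerProj k (lam ^ (1 - cornerLift k (arrivalDir (corner k).1 false))), ?_⟩
  intro d hd β
  simp only [cornerProj_apply]
  rw [hw]
  revert hd
  rw [corner_eq]
  generalize √2 / 2 = σ at *
  fin_cases k <;> rintro (rfl | rfl) <;> cases β <;>
    simp [cornerLift, arrivalDir, v0, v1, v2, v3, w1, w2, w3]
  all_goals (apply Complex.ext <;> simp <;> nlinarith [hs])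

/-- The common factor is a sign, hence real, and can be taken out of the real-linear corner
projection. -/
theorem phase_corner_lift {g p : Face} (hp : p ≠ g) (k : Fin 4) {B : Finset GridEdge}
    {β β' : Bool} (h₁ : side p (corner k).1 ∉ B) (h₂ : side p (corner k).2.1 ∉ B)
    (h : IsConfig g (side p (corner k).1) (farFace p (corner k).1 β)
      (adjoin B β' (side p (corner k).2.1))) :
    ∃ s : ℝ, phase g (side p (corner k).1) (farFace p (corner k).1 β)
        (adjoin B β' (side p (corner k).2.1)) =
          s • lam ^ (1 - cornerLift k (arrivalDir (corner k).1 β)) ∧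
      phase g (side p (corner k).2.1) (farFace p (corner k).2.1 β')
        (adjoin B β (side p (corner k).1)) =
          s • lam ^ (1 - cornerLift k (arrivalDir (corner k).2.1 β')) := by
  have key := spin_corner hp k h₁ h₂ h
  refine ⟨sgn (spin g (side p (corner k).1) (farFace p (corner k).1 β)
    (adjoin B β' (side p (corner k).2.1)) + cornerFlip k (arrivalDir (corner k).1 β)), ?_, ?_⟩
  · have n := sgn_mul_self (cornerFlip k (arrivalDir (corner k).1 β))
    rw [← sgn_cornerFlip_mul, sgn_add, phase, arrival_side, Complex.real_smul, Complex.ofReal_mul]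
    linear_combination (-(sgn (spin _ _ _ _) : ℂ) * dirUnit _) * n
  · have n := sgn_mul_self (cornerFlip k (arrivalDir (corner k).2.1 β'))
    rw [key, ← sgn_cornerFlip_mul, sgn_add, phase, arrival_side, Complex.real_smul,
      Complex.ofReal_mul]
    linear_combination (-(sgn (spin _ _ _ _) : ℂ) * dirUnit _) * n

theorem card_adjoin {B : Finset GridEdge} {β : Bool} {e : GridEdge} (h : e ∉ B) :
    (adjoin B β e).card = B.card + β.toNat := by
  cases β <;> simp [adjoin, h]

/-- Under the exchange at a corner, the weight contributes α to the power |B| + β' and the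
projection α to the power β. The product is symmetric in the two flags, so the projected sums agree
term by term. -/
theorem sHolomorphic_configSum {F : Finset Face} {a : GridEdge} (ha : a ∈ boundaryEdges F) :
    SHolomorphic F (configSum F a) := by
  rw [sHolomorphic_iff_corner]
  intro p hp k
  rw [← cornerProj_apply, ← cornerProj_apply, configSum, configSum, map_sum, map_sum]
  obtain ⟨C, hC⟩ := cornerProj_lam k
  have hpg : p ≠ outerFace F a := fun h => outerFace_notMem ha (h ▸ hp)
  refine sum_configs_eq hp (corner_sides k) fun β β' B h₁ h₂ h => ?_
  obtain ⟨s, e₁, e₂⟩ := phase_corner_lift hpg k h₁ h₂ h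
  simp only
  rw [e₁, e₂, card_adjoin h₁, card_adjoin h₂, ← Complex.ofReal_pow, ← Complex.ofReal_pow,
    ← Complex.real_smul, ← Complex.real_smul, map_smul, map_smul, map_smul, map_smul,
    hC _ (Or.inl rfl), hC _ (Or.inr rfl)]
  simp only [smul_smul]
  congr 1
  ring

/-- A path can reach a boundary edge only outwards, which fixes the arrival direction. Its unit
vector squares to the inverse of τ_cw, and all other factors are real. -/
theorem configSum_mem_rootLine {F : Finset Face} {a z : GridEdge} (hz : z ∈ boundaryEdges F)
    (hza : z ≠ a) : configSum F a z ∈ rootLine (tauCW F z) := by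
  refine Submodule.sum_mem _ fun c hc => ?_
  obtain ⟨⟨hq, hqF⟩, -, -⟩ := mem_configs.mp hc
  have hqF := hqF.resolve_right hza
  rw [face_of_mem (side_entry F z), step_entry] at hq
  have hq := hq.resolve_right fun h => outerFace_notMem hz (h ▸ hqF)
  have harr := arrival_near (entry F z).1 ((entry F z).2 + 2)
  rw [side_entry] at harr
  rw [phase, hq, harr, ← mul_assoc, ← Complex.ofReal_pow, ← Complex.ofReal_mul,
    ← Complex.real_smul]
  refine Submodule.smul_mem _ _ (mem_rootLine_of_sq_mul_eq_one ?_)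
  rw [dirUnit_add_two_sq, tauCW, neg_mul_neg, dirUnit_entry_sq]

/-- The normalized observable is a real multiple of the sum over the configurations. -/
theorem mul_observable_eq {F : Finset Face} {a : GridEdge} (ha : a ∈ boundaryEdges F) {c : ℂ}
    (hc : c ∈ rootLine (tauCCW F a)) :
    ∃ r : ℝ, (fun z => c * observable F a z) = r • configSum F a := by
  obtain ⟨s, hs⟩ := mem_rootLine_tauCCW.mp hc
  obtain ⟨t, ht⟩ := mem_rootLine_tauCCW.mp
    (mem_rootLine_of_sq_mul_eq_one (dirUnit_entry_sq F a))
  have hd := dirUnit_ne_zero (entry F a).2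
  have hr := rootCCW_ne_zero F a
  refine ⟨-(s * t⁻¹ * (partitionFunction F)⁻¹), ?_⟩
  funext z
  rw [observable_eq ha, Pi.smul_apply, Complex.real_smul, ← hs, ← ht]
  have ht0 : (t : ℂ) ≠ 0 := by
    intro h
    rw [h, zero_mul] at ht
    exact hd ht.symm
  push_cast
  rw [inv_neg, mul_inv]
  field_simp

theorem sHolomorphic_observable {F : Finset Face} {a : GridEdge} (ha : a ∈ boundaryEdges F)
    {c : ℂ} (hc : c ∈ rootLine (tauCCW F a)) :
    SHolomorphic F (fun z => c * observable F a z) := by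
  obtain ⟨r, hr⟩ := mul_observable_eq ha hc
  rw [hr]
  exact (sHolomorphic_configSum ha).smul r

theorem observable_mem_rootLine {F : Finset Face} {a z : GridEdge} (ha : a ∈ boundaryEdges F)
    {c : ℂ} (hc : c ∈ rootLine (tauCCW F a)) (hz : z ∈ boundaryEdges F) (hza : z ≠ a) :
    c * observable F a z ∈ rootLine (tauCW F z) := by
  obtain ⟨r, hr⟩ := mul_observable_eq ha hc
  rw [show c * observable F a z = r • configSum F a z from congrFun hr z]
  exact Submodule.smul_mem _ r (configSum_mem_rootLine hz hza)

theorem observable_self (F : Finset Face) (a : GridEdge) : observable F a a = 1 := by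
  simp [observable]

/-- The observables solve the boundary value problem: they are a basis of Green's functions. -/
theorem sHolomorphic_eq_sum_observable {F : Finset Face} {b : Finset GridEdge}
    (hb : b ⊆ boundaryEdges F) {h : GridEdge → ℂ} (hh : SHolomorphic F h) {s : b → ℂ}
    (hs : ∀ k : b, s k ∈ rootLine (tauCCW F k))
    (hsb : ∀ k : b, h k - s k ∈ rootLine (tauCW F k))
    (hb' : ∀ e ∈ boundaryEdges F \ b, h e ∈ rootLine (tauCW F e)) {y : GridEdge}
    (hy : y ∈ edges F) : h y = ∑ k : b, s k * observable F k y := by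
  have hk : SHolomorphic F (∑ k : b, fun y => s k * observable F k y) :=
    SHolomorphic.sum fun k _ => sHolomorphic_observable (hb k.2) (hs k)
  -- It suffices to compare components along τ_ccw^(-1/2): the k-th term contributes s_k at k and
  -- nothing at the other boundary edges.
  rw [eq_of_realPart_eq hh hk (fun e he => ?_) y hy, Finset.sum_apply]
  rw [Finset.sum_apply, map_sum]
  by_cases heb : e ∈ b
  · rw [Finset.sum_eq_single (⟨e, heb⟩ : b)]
    · have := mem_rootLine_tauCW_iff.mp (hsb ⟨e, heb⟩)
      rw [map_sub, sub_eq_zero] at this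
      rw [this, observable_self, mul_one]
    · intro k _ hne
      refine mem_rootLine_tauCW_iff.mp (observable_mem_rootLine (hb k.2) (hs k) he fun h => ?_)
      exact hne (Subtype.ext h.symm)
    · simp
  · rw [mem_rootLine_tauCW_iff.mp (hb' e (Finset.mem_sdiff.mpr ⟨he, heb⟩))]
    refine (Finset.sum_eq_zero fun k _ => ?_).symm
    refine mem_rootLine_tauCW_iff.mp (observable_mem_rootLine (hb k.2) (hs k) he fun h => ?_)
    exact heb (h ▸ k.2)

/-- Both observables from `x` are multiplied by the same root `c`, which puts them into the real
spaces on which the RPS operators act; `c` cancels at the end by complex linearity of the matrix. -/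
theorem observable_union {F₁ F₂ : Finset Face} (hd : Disjoint F₁ F₂)
    {Q : Module.End ℝ (dataR F₂ (commonBoundary F₁ F₂))}
    (hQ : Q * (1 - rpsComp F₁ F₂ hd) = 1)
    {M : Matrix (commonBoundary F₁ F₂) (commonBoundary F₁ F₂) ℂ} (hM : IsMatrixOf Q M)
    {x : GridEdge} (hx : x ∈ boundaryEdges F₁ \ commonBoundary F₁ F₂) {y : GridEdge}
    (hy : y ∈ edges F₂) :
    observable (F₁ ∪ F₂) x y =
      (fun k : commonBoundary F₁ F₂ => observable F₂ k y) ⬝ᵥ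
        (M *ᵥ fun l : commonBoundary F₁ F₂ => observable F₁ x l) := by
  obtain ⟨hxF, hxb⟩ := Finset.mem_sdiff.mp hx
  obtain ⟨hxU, hτ⟩ := mem_boundaryEdges_union_left hd hx
  set c := rootCCW F₁ x with hc
  have hc0 : c ≠ 0 := rootCCW_ne_zero F₁ x
  have hc₁ : c ∈ rootLine (tauCCW F₁ x) := mem_rootLine_tauCCW.mpr ⟨1, by simp [hc]⟩
  have hcU : c ∈ rootLine (tauCCW (F₁ ∪ F₂) x) := by rwa [hτ]
  have hsub₁ := commonBoundary_subset_left (F₁ := F₁) (F₂ := F₂)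
  have hsub₂ := commonBoundary_subset_right (F₁ := F₁) (F₂ := F₂)
  have hCW : ∀ e : commonBoundary F₁ F₂, tauCW F₁ e = tauCCW F₂ e := fun e =>
    tauCW_eq_tauCCW hd (hsub₁ e.2) (hsub₂ e.2)
  have hCW' : ∀ e : commonBoundary F₁ F₂, tauCW F₂ e = tauCCW F₁ e := fun e =>
    tauCW_eq_tauCCW hd.symm (hsub₂ e.2) (hsub₁ e.2)
  -- the observables in the union and in the first domain
  set H : GridEdge → ℂ := fun z => c * observable (F₁ ∪ F₂) x z with hH
  have hHs : SHolomorphic (F₁ ∪ F₂) H := sHolomorphic_observable hxU hcU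
  set H₁ : GridEdge → ℂ := fun z => c * observable F₁ x z with hH₁
  have hH₁s : SHolomorphic F₁ H₁ := sHolomorphic_observable hxF hc₁
  let w : dataR F₂ (commonBoundary F₁ F₂) := ⟨fun l => H₁ l, mem_dataR.mpr fun l => by
    rw [← hCW l]
    exact observable_mem_rootLine hxF hc₁ (hsub₁ l.2) fun h => hxb (h ▸ l.2)⟩
  let s : dataR F₂ (commonBoundary F₁ F₂) :=
    ⟨fun k => realPart F₂ k (H k) * rootCCW F₂ k, mem_dataR.mpr fun k =>
      mem_rootLine_tauCCW.mpr ⟨_, rfl⟩⟩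
  have hr : ∀ k : commonBoundary F₁ F₂,
      H k - (s : commonBoundary F₁ F₂ → ℂ) k ∈ rootLine (tauCW F₂ k) :=
    fun k => sub_realPart_mem F₂ k (H k)
  let r : dataI F₂ (commonBoundary F₁ F₂) :=
    ⟨fun k => H k - (s : commonBoundary F₁ F₂ → ℂ) k, mem_dataI.mpr hr⟩
  let r' : dataR F₁ (commonBoundary F₁ F₂) :=
    ⟨fun k => H k - (s : commonBoundary F₁ F₂ → ℂ) k, mem_dataR.mpr fun k => hCW' k ▸ hr k⟩
  let t : dataI F₁ (commonBoundary F₁ F₂) :=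
    ⟨fun k => (s : commonBoundary F₁ F₂ → ℂ) k - (w : commonBoundary F₁ F₂ → ℂ) k,
      mem_dataI.mpr fun k => by
        rw [hCW k]; exact Submodule.sub_mem _ (dataR_mem s k) (dataR_mem w k)⟩
  have hout : ∀ e ∈ boundaryEdges F₂ \ commonBoundary F₁ F₂, H e ∈ rootLine (tauCW F₂ e) := by
    intro e he
    obtain ⟨heU, hτe⟩ := mem_boundaryEdges_union_right hd he
    rw [tauCW, ← hτe]
    refine observable_mem_rootLine hxU hcU heU fun h => hxb ?_
    exact mem_commonBoundary_of_mem_edges hd (boundaryEdges_subset _ hxF)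
      (h ▸ boundaryEdges_subset _ (Finset.mem_sdiff.mp he).1)
  have hext₂ : HasSHolExtension F₂ (commonBoundary F₁ F₂) s r :=
    ⟨H, hHs.mono Finset.subset_union_right, fun e => by simp [r], hout⟩
  have hext₁ : HasSHolExtension F₁ (commonBoundary F₁ F₂) r' t := by
    -- Both functions equal `c` at `x`, so their difference also satisfies the boundary condition
    -- there.
    refine ⟨H - H₁, (hHs.mono Finset.subset_union_left).sub hH₁s, fun e => by simp [r', t, w],
      fun e he => ?_⟩
    by_cases hex : e = x
    · simp [hH, hH₁, hex, observable_self]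
    · obtain ⟨heU, hτe⟩ := mem_boundaryEdges_union_left hd he
      refine Submodule.sub_mem _ ?_
        (observable_mem_rootLine hxF hc₁ (Finset.mem_sdiff.mp he).1 hex)
      rw [tauCW, ← hτe]
      exact observable_mem_rootLine hxU hcU heU hex
  have hsw : Q w = s := by
    -- The two extensions say r = U₂s and s - w = U₁r, that is, U₁U₂s = s - w.
    have h₁ : (1 - rpsComp F₁ F₂ hd : Module.End ℝ (dataR F₂ (commonBoundary F₁ F₂))) s = w := by
      apply Subtype.ext
      rw [LinearMap.sub_apply, Module.End.one_apply, Submodule.coe_sub,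
        rpsComp_coe hd hext₂ rfl hext₁]
      funext k
      simp [t]
    rw [← h₁, ← Module.End.mul_apply, hQ, Module.End.one_apply]
  have hval : H y = ∑ k : commonBoundary F₁ F₂,
      (s : commonBoundary F₁ F₂ → ℂ) k * observable F₂ k y :=
    sHolomorphic_eq_sum_observable hsub₂ (hHs.mono Finset.subset_union_right)
      (dataR_mem s) hr hout hy
  have hMw := hM w
  rw [hsw] at hMw
  have hw : (w : commonBoundary F₁ F₂ → ℂ) =
      c • fun l : commonBoundary F₁ F₂ => observable F₁ x l := rfl
  rw [hw, Matrix.mulVec_smul] at hMw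
  apply mul_left_cancel₀ hc0
  rw [← smul_eq_mul c (_ ⬝ᵥ _), ← dotProduct_smul, hMw]
  refine hval.trans (Finset.sum_congr rfl fun k _ => mul_comm _ _)

end IsingGluing

open IsingGluing

/-! ### The gluing theorem -/

theorem mainTheorem11 (F₁ F₂ : Finset Face) (h₁ : IsGridDomain F₁) (h₂ : IsGridDomain F₂)
    (hd : Disjoint F₁ F₂) :
    (∀ u v, HasSHolExtension F₁ (commonBoundary F₁ F₂) u v ↔
      v = rps F₁ (commonBoundary F₁ F₂) u) ∧
    (∀ u v, HasSHolExtension F₂ (commonBoundary F₁ F₂) u v ↔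
      v = rps F₂ (commonBoundary F₁ F₂) u) ∧
    ∃ Q : Module.End ℝ (dataR F₂ (commonBoundary F₁ F₂)),
      (1 - rpsComp F₁ F₂ hd) * Q = 1 ∧ Q * (1 - rpsComp F₁ F₂ hd) = 1 ∧
      (∃! M, IsMatrixOf Q M) ∧
      ∀ M, IsMatrixOf Q M →
        ∀ x ∈ boundaryEdges F₁ \ commonBoundary F₁ F₂, ∀ y ∈ edges F₂,
          observable (F₁ ∪ F₂) x y =
            (fun k : commonBoundary F₁ F₂ => observable F₂ k y) ⬝ᵥ
              (M *ᵥ fun l : commonBoundary F₁ F₂ => observable F₁ x l) := by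
  obtain ⟨Q, hQ₁, hQ₂⟩ := exists_inverse_one_sub_rpsComp hd
  exact ⟨hasSHolExtension_iff commonBoundary_subset_left,
    hasSHolExtension_iff commonBoundary_subset_right, Q, hQ₁, hQ₂, existsUnique_isMatrixOf Q,
    fun M hM x hx y hy => observable_union hd hQ₂ hM hx hy⟩
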